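/- **Theorem.** Let $d\in\mathbb N$, $L\ge 0$ and $0<c_1\le c_2$. There are $C>0$ and $n_0\in\mathbb N$, depending only on $d,L,c_1,c_2$, such that the following holds. Let $a\in C^2(\mathbb R^d)$ with $\|a\|_{C^2}=\max_{|k|\le 2}\|D^k a\|_\infty=L$, let $p^*(x)\propto \exp(-|x|^2/2-a(x))$ be a probability density on $\mathbb R^d$, with distribution $\mathbb P^*$, let $n\ge n_0$, and let $\sigma_{\min}>0$ satisfy $c_1\log n\le\log(\sigma_{\min}^{-1})\le c_2\log n$. For $t\in[0,1]$ put $\mu_t(y)=ty$ and $\sigma_t=\sigma_{\min}^t$, let $p_t(\cdot|y)\propto\exp\big(-\frac{|\cdot-\mu_t(y)|^2}{2\sigma_t^2}\big)$ be the density of $\mathcal N(\mu_t(y),\sigma_t^2 I_d)$, and set $$v_t(x|y)=\frac{\sigma_t'}{\sigma_t}(x-\mu_t(y))+\mu_t'(y),\qquad p_t(x)=\int p_t(x|y)p^*(y)\,dy,\qquad v_t(x)=\int v_t(x|y)\frac{p_t(x|y)p^*(y)}{p_t(x)}\,dy,$$ where the prime denotes the derivative in $t$. Let $\mathcal M$ be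 any set of continuous functions $w\colon[0,1]\times\mathbb R^d\to\mathbb R^d$ each of whose components is bounded in absolute value by $$e^{2L}\log(n)^3+(1+e^{2L})\log(n)^2+\log(n)+1 .$$ For $w\in\mathcal M$ and $y\in\mathbb R^d$ let $$g(w,y)=\int_0^1\int |w_t(x)-v_t(x|y)|^2\,p_t(x|y)\,dx\,dt .$$ For $\tau>0$ let $\mathcal N(\tau,g(\mathcal M),\|\cdot\|_\infty)$ be the least number of closed balls of radius $\tau$, with arbitrary centres, that cover $g(\mathcal M)=\{g(w,\cdot): w\in\mathcal M\}$ in the supremum norm over the cube $[-\log n,\log n]^d$ (it is at most the covering number in the supremum norm over $\mathbb R^d$). Let $X_1^*,\dots,X_n^*$ be i.i.d. with law $\mathbb P^*$. Then for every $\alpha\in(0,1]$ and $\tau>0$, with probability at least $1-\frac1n$, every empirical risk minimiser $\hat v\in\operatorname{argmin}_{w\in\mathcal M}\frac1n\sum_{i=1}^n g(w,X_i^*)$ satisfies $$\int_0^1\!\!\int|\hat v_t(x)-v_t(x)|^2p_t(x)\,dx\,dt\;\le\; C\Big(\inf_{w\in\mathcal M}\int_0^1\!\!\int|w_t(x)-v_t(x)|^2p_t(x)\,dx\,dt+n^{-1/2}+\frac{\alpha^{-1}\log(n)^7}{n}\log\big(2\mathcal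 N(\tau,g(\mathcal M),\|\cdot\|_\infty)\big)+(2+\alpha)\tau+\alpha\log(n)^6\Big).$$ (If the covering number is infinite, the right-hand side is $+\infty$ and nothing is claimed.) -/

import Mathlib

open MeasureTheory ProbabilityTheory
open scoped NNReal ENNReal unitInterval UniformConvergence

noncomputable section

namespace FlowMatching

/-- `ℝ^d` with the Euclidean norm. -/
abbrev E (d : ℕ) := EuclideanSpace ℝ (Fin d)

/-- The probability density proportional to the nonnegative integrable function `f`. -/
def normalize {d : ℕ} (f : E d → ℝ) (x : E d) : ℝ :=
  f x / ∫ z, f z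

/-- `‖f‖_{C^2}`: the largest sup norm of a partial derivative of `f` of order at most two. The
derivative `∂_{i 0} ⋯ ∂_{i (k-1)} f` is the `k`-th derivative evaluated at basis vectors. -/
def c2Norm {d : ℕ} (f : E d → ℝ) : ℝ≥0∞ :=
  ⨆ (k : ℕ) (_ : k ≤ 2) (i : Fin k → Fin d) (x : E d),
    ‖iteratedFDeriv ℝ k f x (fun j => EuclideanSpace.single (i j) (1 : ℝ))‖ₑ

/-- The density `p*(x) ∝ exp(-|x|²/2 - a(x))`. -/
def targetDensity {d : ℕ} (a : E d → ℝ) : E d → ℝ :=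
  normalize fun x => Real.exp (-‖x‖ ^ 2 / 2 - a x)

/-- The distribution `ℙ*` with Lebesgue density `p*`. -/
def targetMeasure {d : ℕ} (a : E d → ℝ) : Measure (E d) :=
  volume.withDensity fun x => ENNReal.ofReal (targetDensity a x)

/-- The mean shift `μ_t(y) = t y`. -/
def meanShift {d : ℕ} (t : ℝ) (y : E d) : E d := t • y

/-- The variance function `σ_t = (σ_min)^t`. -/
def stdDev (σmin : ℝ) (t : ℝ) : ℝ := σmin ^ t

/-- The conditional density `p_t(x | y) ∝ exp(-|x - μ_t(y)|² / (2 σ_t²))`. -/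
def condDensity {d : ℕ} (σmin t : ℝ) (y : E d) : E d → ℝ :=
  normalize fun x => Real.exp (-‖x - meanShift t y‖ ^ 2 / (2 * stdDev σmin t ^ 2))

/-- The conditional vector field `v_t(x | y) = (σ_t' / σ_t) (x - μ_t(y)) + μ_t'(y)`, where the
prime is the derivative in time. -/
def condField {d : ℕ} (σmin t : ℝ) (y x : E d) : E d :=
  (deriv (stdDev σmin) t / stdDev σmin t) • (x - meanShift t y) +
    deriv (fun s => meanShift s y) t

/-- The marginal density `p_t(x) = ∫ p_t(x | y) p*(y) dy`. -/
def margDensity {d : ℕ} (a : E d → ℝ) (σmin t : ℝ) (x : E d) : ℝ :=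
  ∫ y, condDensity σmin t y x * targetDensity a y

/-- The marginal vector field `v_t(x) = ∫ v_t(x | y) p_t(x | y) p*(y) / p_t(x) dy`. -/
def margField {d : ℕ} (a : E d → ℝ) (σmin t : ℝ) (x : E d) : E d :=
  ∫ y, (condDensity σmin t y x * targetDensity a y / margDensity a σmin t x) •
    condField σmin t y x

/-- Continuous vector fields `[0,1] × ℝ^d → ℝ^d`. -/
abbrev VField (d : ℕ) := C(I × E d, E d)

/-- `𝔼_{t ∼ U[0,1], X_t ∼ p_t} |w_t(X_t) - v_t(X_t)|²`. -/
def fmError {d : ℕ} (a : E d → ℝ) (σmin : ℝ) (w : VField d) : ℝ :=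
  ∫ t : I, ∫ x : E d, ‖w (t, x) - margField a σmin t x‖ ^ 2 * margDensity a σmin t x

/-- The loss `g(w, y) = ∫_0^1 ∫ |w_t(x) - v_t(x | y)|² p_t(x | y) dx dt`. -/
def loss {d : ℕ} (σmin : ℝ) (w : VField d) (y : E d) : ℝ :=
  ∫ t : I, ∫ x : E d, ‖w (t, x) - condField σmin t y x‖ ^ 2 * condDensity σmin t y x

/-- The empirical conditional Flow Matching objective for the sample `Y_1, …, Y_n`. -/
def empiricalObjective {d n : ℕ} (σmin : ℝ) (Y : Fin n → E d) (w : VField d) : ℝ :=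
  (1 / (n : ℝ)) * ∑ i, loss σmin w (Y i)

/-- The bound `e^{2L} log(n)³ + (1 + e^{2L}) log(n)² + log(n) + 1` on the components. -/
def fieldBound (L : ℝ) (n : ℕ) : ℝ :=
  Real.exp (2 * L) * Real.log n ^ 3 + (1 + Real.exp (2 * L)) * Real.log n ^ 2 + Real.log n + 1

/-- The cube `[-log n, log n]^d`. -/
def logCube (d n : ℕ) : Set (E d) :=
  {y | ∀ j, |y j| ≤ Real.log n}

/-- The class `g(M) = {g(w, ·) : w ∈ M}` of functions on the cube `[-log n, log n]^d`, inside the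
space of all real functions on the cube with the distance of uniform convergence. -/
def lossClass {d : ℕ} (σmin : ℝ) (n : ℕ) (M : Set (VField d)) : Set (logCube d n →ᵤ ℝ) :=
  (fun w => UniformFun.ofFun fun y : logCube d n => loss σmin w (y : E d)) '' M

/-- The covering number `𝒩(τ, g(M), ‖·‖_∞)`: the least number of closed sup norm balls of radius
`τ` that cover `g(M)`. -/
def coveringNum {d : ℕ} (σmin : ℝ) (n : ℕ) (M : Set (VField d)) (τ : ℝ≥0) : ℕ∞ :=
  Metric.externalCoveringNumber τ (lossClass σmin n M)

end FlowMatching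

end

namespace FlowMatching

/-! The marginal field at `(t, x)` is the mean of `v_t(x | y)` under the posterior density `p_t(x |
y) p*(y) / p_t(x)`. Expanding the square around this mean and applying Fubini, the expected loss of
`w` is `fmError` plus a term free of `w` (`integral_loss_eq`). Differences of marginal errors are
therefore differences of expected losses, and an oracle inequality for empirical risk minimisation
remains.

The loss is unbounded in `y` but grows only quadratically (`loss_le`), and `p*` has Gaussian tails
because `a` is bounded. Outside the cube the mass and the expected loss are thus of order `log(n)^6
exp(-log(n)^2 / 4)`, smaller than any power of `n`. On the cube the loss is at most `b = K
log(n)^6`, so Hoeffding's inequality applies to the truncated losses of the finitely many members of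
a cover.

The deviation allowed is `s = b (α + α⁻¹ log(4 N n) / n)`. By the inequality of arithmetic and
geometric means `s ≥ 2 b √(log(4 N n) / n)`, which beats the union bound for every `α`
(`union_bound_le`). No variance estimate is needed, at the price of the term `α log(n)^6`. The
comparison of minimiser, competitor and their neighbours in the cover is then deterministic
(`integral_le_of_sum_le`). -/

/-! ### Gaussian integrals. -/

lemma integrable_exp_neg_mul_sq_norm (d : ℕ) {b : ℝ} (hb : 0 < b) :
    Integrable (fun z : E d => Real.exp (-(b * ‖z‖ ^ 2))) := by
  have h := (GaussianFourier.integrable_cexp_neg_mul_sq_norm_add (V := E d) (b := (b : ℂ))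
    (by simpa using hb) 0 0).norm
  refine h.congr (Filter.Eventually.of_forall fun z => ?_)
  simp only [zero_mul, add_zero, Complex.norm_exp]
  congr 1
  rw [show -(b : ℂ) * (‖z‖ : ℂ) ^ 2 = ((-(b * ‖z‖ ^ 2) : ℝ) : ℂ) by push_cast; ring,
    Complex.ofReal_re]

lemma integrable_one_add_sq_norm_mul_exp (d : ℕ) {b : ℝ} (hb : 0 < b) :
    Integrable (fun z : E d => (1 + ‖z‖ ^ 2) * Real.exp (-(b * ‖z‖ ^ 2))) := by
  refine ((integrable_exp_neg_mul_sq_norm d (half_pos hb)).const_mul (1 + 2 / b)).mono'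
    (by fun_prop) (Filter.Eventually.of_forall fun z => ?_)
  rw [Real.norm_of_nonneg (by positivity)]
  have h1 : Real.exp (-(b * ‖z‖ ^ 2))
      = Real.exp (-(b / 2 * ‖z‖ ^ 2)) * Real.exp (-(b / 2 * ‖z‖ ^ 2)) := by
    rw [← Real.exp_add]; ring_nf
  -- One half of the exponent absorbs the polynomial, by `exp u ≥ 1 + u`; the other half remains
  -- integrable.
  have h2 : (1 + ‖z‖ ^ 2) * Real.exp (-(b / 2 * ‖z‖ ^ 2)) ≤ 1 + 2 / b := by
    rw [Real.exp_neg, ← div_eq_mul_inv, div_le_iff₀ (Real.exp_pos _)]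
    have h3 := Real.add_one_le_exp (b / 2 * ‖z‖ ^ 2)
    calc 1 + ‖z‖ ^ 2 ≤ (1 + 2 / b) * (b / 2 * ‖z‖ ^ 2 + 1) := by
          have : (1 + 2 / b) * (b / 2 * ‖z‖ ^ 2 + 1)
            = 1 + ‖z‖ ^ 2 + (b / 2 * ‖z‖ ^ 2 + 2 / b) := by field_simp; ring
          rw [this]
          have : 0 ≤ b / 2 * ‖z‖ ^ 2 + 2 / b := by positivity
          linarith
      _ ≤ _ := by gcongr
  rw [h1, ← mul_assoc]
  gcongr

/-- The total mass of `exp (-‖z‖² / 2)`. -/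
noncomputable def gaussianMass (d : ℕ) : ℝ := ∫ z : E d, Real.exp (-‖z‖ ^ 2 / 2)

/-- The second moment of the standard Gaussian distribution. -/
noncomputable def gaussianSecondMoment (d : ℕ) : ℝ :=
  (∫ z : E d, ‖z‖ ^ 2 * Real.exp (-‖z‖ ^ 2 / 2)) / gaussianMass d

lemma integrable_gaussian (d : ℕ) : Integrable (fun z : E d => Real.exp (-‖z‖ ^ 2 / 2)) := by
  convert integrable_exp_neg_mul_sq_norm d (b := 1 / 2) (by norm_num) using 3
  ring

lemma integrable_sq_norm_mul_gaussian (d : ℕ) :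
    Integrable (fun z : E d => ‖z‖ ^ 2 * Real.exp (-‖z‖ ^ 2 / 2)) := by
  convert (integrable_one_add_sq_norm_mul_exp d (b := 1 / 2) (by norm_num)).sub
    (integrable_gaussian d) using 2 with z
  simp only [Pi.sub_apply]
  rw [show -(1 / 2 * ‖z‖ ^ 2) = -‖z‖ ^ 2 / 2 by ring]
  ring

lemma gaussianMass_pos (d : ℕ) : 0 < gaussianMass d := integral_exp_pos (integrable_gaussian d)

lemma gaussianSecondMoment_nonneg (d : ℕ) : 0 ≤ gaussianSecondMoment d :=
  div_nonneg (integral_nonneg fun _ => by positivity) (gaussianMass_pos d).le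

variable {d : ℕ}

/-! ### The conditional density and field. -/

lemma gaussian_smul (s : ℝ) (hσ : 0 < s) (z : E d) :
    Real.exp (-‖s • z‖ ^ 2 / (2 * s ^ 2)) = Real.exp (-‖z‖ ^ 2 / 2) := by
  congr 1
  rw [norm_smul, Real.norm_of_nonneg hσ.le]
  field_simp

lemma integral_mul_gaussian_sub (f : E d → ℝ) (m : E d) {s : ℝ} (hσ : 0 < s) :
    ∫ x, f (x - m) * Real.exp (-‖x - m‖ ^ 2 / (2 * s ^ 2))
      = s ^ d * ∫ z, f (s • z) * Real.exp (-‖z‖ ^ 2 / 2) := by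
  rw [integral_sub_right_eq_self (fun x : E d => f x * Real.exp (-‖x‖ ^ 2 / (2 * s ^ 2))) m]
  have h := Measure.integral_comp_smul_of_nonneg (volume : Measure (E d))
    (fun x : E d => f x * Real.exp (-‖x‖ ^ 2 / (2 * s ^ 2))) s (hR := hσ.le)
  simp only [gaussian_smul s hσ] at h
  rw [h, finrank_euclideanSpace_fin, smul_eq_mul, ← mul_assoc, mul_inv_cancel₀ (by positivity),
    one_mul]

lemma integrable_mul_gaussian_sub {f : E d → ℝ} (m : E d) {s : ℝ} (hσ : 0 < s)
    (hf : Integrable fun z => f (s • z) * Real.exp (-‖z‖ ^ 2 / 2)) :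
    Integrable fun x => f (x - m) * Real.exp (-‖x - m‖ ^ 2 / (2 * s ^ 2)) := by
  have h : Integrable fun x : E d => f x * Real.exp (-‖x‖ ^ 2 / (2 * s ^ 2)) := by
    rw [← integrable_comp_smul_iff volume _ hσ.ne']
    simpa only [gaussian_smul s hσ] using hf
  exact h.comp_sub_right m

lemma stdDev_pos {σmin : ℝ} (hσ : 0 < σmin) (t : ℝ) : 0 < stdDev σmin t := Real.rpow_pos_of_pos hσ t

lemma stdDev_le_one {σmin t : ℝ} (hσ : 0 < σmin) (h1 : σmin ≤ 1) (ht : 0 ≤ t) :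
    stdDev σmin t ≤ 1 := Real.rpow_le_one hσ.le h1 ht

lemma continuous_stdDev {σmin : ℝ} (hσ : 0 < σmin) : Continuous (stdDev σmin) :=
  Real.continuous_const_rpow hσ.ne'

lemma condDensity_eq {σmin : ℝ} (hσ : 0 < σmin) (t : ℝ) (y x : E d) :
    condDensity σmin t y x = (stdDev σmin t ^ d * gaussianMass d)⁻¹ *
      Real.exp (-‖x - t • y‖ ^ 2 / (2 * stdDev σmin t ^ 2)) := by
  have h := integral_mul_gaussian_sub (fun _ => 1) (t • y) (stdDev_pos hσ t)
  simp only [one_mul] at h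
  rw [condDensity, normalize, meanShift, h, gaussianMass]
  field_simp

lemma condDensity_pos {σmin : ℝ} (hσ : 0 < σmin) (t : ℝ) (y x : E d) :
    0 < condDensity σmin t y x := by
  rw [condDensity_eq hσ]
  have := gaussianMass_pos d
  have := stdDev_pos hσ t
  positivity

lemma condDensity_le {σmin : ℝ} (hσ : 0 < σmin) (t : ℝ) (y x : E d) :
    condDensity σmin t y x ≤ (stdDev σmin t ^ d * gaussianMass d)⁻¹ := by
  rw [condDensity_eq hσ]
  have := gaussianMass_pos d
  have := stdDev_pos hσ t
  refine mul_le_of_le_one_right (by positivity) (Real.exp_le_one_iff.2 ?_)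
  rw [neg_div]
  exact neg_nonpos.2 (by positivity)

lemma condField_eq {σmin : ℝ} (hσ : 0 < σmin) (t : ℝ) (y x : E d) :
    condField σmin t y x = Real.log σmin • (x - t • y) + y := by
  have h1 : deriv (stdDev σmin) t = stdDev σmin t * Real.log σmin := by
    have := (Real.hasStrictDerivAt_const_rpow hσ t).hasDerivAt
    exact this.deriv
  have h2 : deriv (fun s => meanShift s y) t = y := by
    have := ((hasDerivAt_id t).smul_const y).deriv
    simpa [meanShift] using this
  rw [condField, h1, h2, mul_div_cancel_left₀ _ (stdDev_pos hσ t).ne', meanShift]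

lemma continuous_condDensity {σmin : ℝ} (hσ : 0 < σmin) :
    Continuous fun q : (ℝ × E d) × E d => condDensity (d := d) σmin q.1.1 q.2 q.1.2 := by
  simp only [condDensity_eq hσ]
  have h := continuous_stdDev hσ
  have h0 : ∀ t, stdDev σmin t ≠ 0 := fun t => (stdDev_pos hσ t).ne'
  have h1 := (gaussianMass_pos d).ne'
  refine Continuous.mul (Continuous.inv₀ (by fun_prop) fun q => mul_ne_zero (pow_ne_zero _ (h0 _)) h1)
    (Real.continuous_exp.comp (Continuous.div (by fun_prop) (by fun_prop) fun q => ?_))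
  exact mul_ne_zero two_ne_zero (pow_ne_zero _ (h0 _))

lemma continuous_condField {σmin : ℝ} (hσ : 0 < σmin) :
    Continuous fun q : (ℝ × E d) × E d => condField (d := d) σmin q.1.1 q.2 q.1.2 := by
  simp only [condField_eq hσ]
  fun_prop

lemma integrable_condDensity {σmin : ℝ} (hσ : 0 < σmin) (t : ℝ) (y : E d) :
    Integrable (condDensity σmin t y) := by
  have h := integrable_mul_gaussian_sub (f := fun _ => 1) (t • y) (stdDev_pos hσ t)
    (by simpa using integrable_gaussian d)
  simp only [one_mul] at h
  simpa only [← condDensity_eq hσ] using h.const_mul (stdDev σmin t ^ d * gaussianMass d)⁻¹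

lemma integral_condDensity {σmin : ℝ} (hσ : 0 < σmin) (t : ℝ) (y : E d) :
    ∫ x, condDensity σmin t y x = 1 := by
  have h := integral_mul_gaussian_sub (fun _ => 1) (t • y) (stdDev_pos hσ t)
  simp only [one_mul] at h
  simp only [condDensity_eq hσ, integral_const_mul, h]
  exact inv_mul_cancel₀ (mul_pos (pow_pos (stdDev_pos hσ t) d) (gaussianMass_pos d)).ne'

lemma integrable_sq_norm_sub_mul_condDensity {σmin : ℝ} (hσ : 0 < σmin) (t : ℝ) (y : E d) :
    Integrable fun x => ‖x - t • y‖ ^ 2 * condDensity σmin t y x := by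
  have h := integrable_mul_gaussian_sub (f := fun z : E d => ‖z‖ ^ 2) (t • y) (stdDev_pos hσ t) (by
    simp only [norm_smul, mul_pow, mul_assoc]
    exact (integrable_sq_norm_mul_gaussian d).const_mul _)
  refine (h.const_mul (stdDev σmin t ^ d * gaussianMass d)⁻¹).congr
    (Filter.Eventually.of_forall fun x => ?_)
  simp only [condDensity_eq hσ]
  ring

lemma integral_sq_norm_sub_mul_condDensity {σmin : ℝ} (hσ : 0 < σmin) (t : ℝ) (y : E d) :
    ∫ x, ‖x - t • y‖ ^ 2 * condDensity σmin t y x = stdDev σmin t ^ 2 * gaussianSecondMoment d := by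
  have h := integral_mul_gaussian_sub (fun z : E d => ‖z‖ ^ 2) (t • y) (stdDev_pos hσ t)
  have h1 : ∀ x, ‖x - t • y‖ ^ 2 * condDensity σmin t y x
      = (stdDev σmin t ^ d * gaussianMass d)⁻¹ *
        (‖x - t • y‖ ^ 2 * Real.exp (-‖x - t • y‖ ^ 2 / (2 * stdDev σmin t ^ 2))) := fun x => by
    rw [condDensity_eq hσ]; ring
  simp only [h1, integral_const_mul, h]
  have h2 : ∀ z : E d, ‖stdDev σmin t • z‖ ^ 2 * Real.exp (-‖z‖ ^ 2 / 2)
      = stdDev σmin t ^ 2 * (‖z‖ ^ 2 * Real.exp (-‖z‖ ^ 2 / 2)) := fun z => by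
    rw [norm_smul, mul_pow, Real.norm_eq_abs, sq_abs]; ring
  simp only [h2, integral_const_mul, gaussianSecondMoment]
  have := (gaussianMass_pos d).ne'
  have := (stdDev_pos hσ t).ne'
  field_simp

/-- The bias-variance decomposition for a weighted mean. -/
lemma integral_mul_sq_norm_sub_eq {S F : Type*} [MeasurableSpace S] [NormedAddCommGroup F]
    [InnerProductSpace ℝ F] [CompleteSpace F] {ν : Measure S} {p : S → ℝ} {v : S → F}
    (hp : Integrable p ν) (hv : Integrable (fun y => p y • v y) ν)
    (hv2 : Integrable (fun y => p y * ‖v y‖ ^ 2) ν) (w m : F)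
    (hm : (∫ y, p y ∂ν) • m = ∫ y, p y • v y ∂ν) :
    ∫ y, ‖w - v y‖ ^ 2 * p y ∂ν
      = ‖w - m‖ ^ 2 * (∫ y, p y ∂ν) + ∫ y, ‖m - v y‖ ^ 2 * p y ∂ν := by
  have hin : ∀ z : F, Integrable (fun y => inner ℝ z (p y • v y)) ν := fun z => hv.const_inner z
  -- Valid for every centre `z`; taken at `z = w` and `z = m`, the second moment of `v` cancels from
  -- the difference.
  have hexp : ∀ z : F, ∫ y, ‖z - v y‖ ^ 2 * p y ∂ν
      = ‖z‖ ^ 2 * (∫ y, p y ∂ν) - 2 * inner ℝ z ((∫ y, p y ∂ν) • m)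
        + ∫ y, p y * ‖v y‖ ^ 2 ∂ν := fun z => by
    have h1 : ∀ y, ‖z - v y‖ ^ 2 * p y
        = ‖z‖ ^ 2 * p y - 2 * inner ℝ z (p y • v y) + p y * ‖v y‖ ^ 2 := fun y => by
      rw [norm_sub_sq_real, inner_smul_right]; ring
    simp only [h1]
    have h2 : Integrable (fun y => ‖z‖ ^ 2 * p y - 2 * inner ℝ z (p y • v y)) ν :=
      (hp.const_mul _).sub ((hin z).const_mul _)
    rw [integral_add h2 hv2, integral_sub (hp.const_mul _) ((hin z).const_mul _),
      integral_const_mul, integral_const_mul, hm, integral_inner hv z]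
  rw [hexp, hexp, norm_sub_sq_real, inner_smul_right, inner_smul_right,
    real_inner_self_eq_norm_sq]
  ring

/-! ### Gaussian domination of the target density. -/

section Target

variable {a : E d → ℝ} {L : ℝ}

lemma continuous_targetDensity (ha : Continuous a) : Continuous (targetDensity a) := by
  unfold targetDensity normalize
  fun_prop

lemma targetDensity_nonneg (x : E d) : 0 ≤ targetDensity a x :=
  div_nonneg (Real.exp_pos _).le (integral_nonneg fun _ => (Real.exp_pos _).le)

lemma exp_target_le (hL : ∀ x, |a x| ≤ L) (x : E d) :
    Real.exp (-‖x‖ ^ 2 / 2 - a x) ≤ Real.exp L * Real.exp (-‖x‖ ^ 2 / 2) := by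
  rw [← Real.exp_add]
  exact Real.exp_le_exp.2 (by linarith [neg_abs_le (a x), hL x])

lemma integrable_exp_target (ha : Continuous a) (hL : ∀ x, |a x| ≤ L) :
    Integrable fun x : E d => Real.exp (-‖x‖ ^ 2 / 2 - a x) := by
  refine ((integrable_gaussian d).const_mul (Real.exp L)).mono' (by fun_prop)
    (Filter.Eventually.of_forall fun x => ?_)
  rw [Real.norm_of_nonneg (Real.exp_pos _).le]
  exact exp_target_le hL x

/-- One factor `exp L` comes from the numerator, the other from the lower bound `exp (-L) *
gaussianMass d` for the normalising integral. -/
lemma targetDensity_le (ha : Continuous a) (hL : ∀ x, |a x| ≤ L) (x : E d) :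
    targetDensity a x ≤ Real.exp (2 * L) / gaussianMass d * Real.exp (-‖x‖ ^ 2 / 2) := by
  have h1 : Real.exp (-L) * gaussianMass d ≤ ∫ x, Real.exp (-‖x‖ ^ 2 / 2 - a x) := by
    rw [gaussianMass, ← integral_const_mul]
    refine integral_mono ((integrable_gaussian d).const_mul _) (integrable_exp_target ha hL)
      fun x => ?_
    simp only [← Real.exp_add]
    exact Real.exp_le_exp.2 (by linarith [le_abs_self (a x), hL x])
  have h2 := gaussianMass_pos d
  calc targetDensity a x
      ≤ Real.exp L * Real.exp (-‖x‖ ^ 2 / 2) / (Real.exp (-L) * gaussianMass d) :=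
        div_le_div₀ (by positivity) (exp_target_le hL x) (by positivity) h1
    _ = _ := by
        rw [Real.exp_neg, two_mul, Real.exp_add]
        field_simp

lemma isProbabilityMeasure_targetMeasure (ha : Continuous a) (hL : ∀ x, |a x| ≤ L) :
    IsProbabilityMeasure (targetMeasure a) := by
  constructor
  have hi : Integrable (targetDensity a) := (integrable_exp_target ha hL).div_const _
  rw [targetMeasure, withDensity_apply _ MeasurableSet.univ, Measure.restrict_univ,
    ← ofReal_integral_eq_lintegral_ofReal hi
      (Filter.Eventually.of_forall fun x => targetDensity_nonneg x)]
  simp only [targetDensity, normalize, integral_div]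
  rw [div_self (integral_exp_pos (integrable_exp_target ha hL)).ne', ENNReal.ofReal_one]

lemma integral_targetMeasure {F : Type*} [NormedAddCommGroup F] [NormedSpace ℝ F]
    (ha : Continuous a) (f : E d → F) :
    ∫ y, f y ∂(targetMeasure a) = ∫ y, targetDensity a y • f y := by
  rw [targetMeasure, integral_withDensity_eq_integral_toReal_smul
    (continuous_targetDensity ha).measurable.ennreal_ofReal (by simp)]
  simp only [ENNReal.toReal_ofReal (targetDensity_nonneg _)]

lemma integrable_targetMeasure_iff {F : Type*} [NormedAddCommGroup F] [NormedSpace ℝ F]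
    (ha : Continuous a) (f : E d → F) :
    Integrable f (targetMeasure a) ↔ Integrable fun y => targetDensity a y • f y := by
  rw [targetMeasure, integrable_withDensity_iff_integrable_smul'
    (continuous_targetDensity ha).measurable.ennreal_ofReal (by simp)]
  simp only [ENNReal.toReal_ofReal (targetDensity_nonneg _)]

/-- An exponential moment for Chernoff-type tail bounds: the weight uses up half of the Gaussian
exponent. The factor `1 + ‖y‖ ^ 2` is there because the loss grows quadratically. -/
lemma integrable_one_add_sq_norm_mul_exp_targetMeasure (ha : Continuous a)
    (hL : ∀ x, |a x| ≤ L) :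
    Integrable (fun y => (1 + ‖y‖ ^ 2) * Real.exp (‖y‖ ^ 2 / 4)) (targetMeasure a) ∧
    ∫ y, (1 + ‖y‖ ^ 2) * Real.exp (‖y‖ ^ 2 / 4) ∂(targetMeasure a) ≤
      Real.exp (2 * L) / gaussianMass d *
        ∫ y : E d, (1 + ‖y‖ ^ 2) * Real.exp (-(1 / 4 * ‖y‖ ^ 2)) := by
  have hg := (integrable_one_add_sq_norm_mul_exp d (b := 1 / 4) (by norm_num)).const_mul
    (Real.exp (2 * L) / gaussianMass d)
  have hle : ∀ y : E d, targetDensity a y • ((1 + ‖y‖ ^ 2) * Real.exp (‖y‖ ^ 2 / 4)) ≤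
      Real.exp (2 * L) / gaussianMass d * ((1 + ‖y‖ ^ 2) * Real.exp (-(1 / 4 * ‖y‖ ^ 2))) :=
    fun y => by
      rw [smul_eq_mul]
      calc _ ≤ Real.exp (2 * L) / gaussianMass d * Real.exp (-‖y‖ ^ 2 / 2) *
            ((1 + ‖y‖ ^ 2) * Real.exp (‖y‖ ^ 2 / 4)) := by
            gcongr
            exact targetDensity_le ha hL y
        _ = _ := by
            rw [show -(1 / 4 * ‖y‖ ^ 2) = -‖y‖ ^ 2 / 2 + ‖y‖ ^ 2 / 4 by ring, Real.exp_add]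
            ring
  have hi : Integrable fun y : E d =>
      targetDensity a y • ((1 + ‖y‖ ^ 2) * Real.exp (‖y‖ ^ 2 / 4)) := by
    refine hg.mono' ?_ (Filter.Eventually.of_forall fun y => ?_)
    · have := continuous_targetDensity ha
      exact Continuous.aestronglyMeasurable (by fun_prop)
    · rw [Real.norm_of_nonneg (smul_nonneg (targetDensity_nonneg y) (by positivity))]
      exact hle y
  refine ⟨(integrable_targetMeasure_iff ha _).2 hi, ?_⟩
  rw [integral_targetMeasure ha, ← integral_const_mul]
  exact integral_mono hi hg hle

lemma integrable_one_add_sq_norm_targetMeasure (ha : Continuous a) (hL : ∀ x, |a x| ≤ L) :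
    Integrable (fun y => 1 + ‖y‖ ^ 2) (targetMeasure a) := by
  refine (integrable_one_add_sq_norm_mul_exp_targetMeasure ha hL).1.mono' (by fun_prop)
    (Filter.Eventually.of_forall fun y => ?_)
  rw [Real.norm_of_nonneg (by positivity)]
  exact le_mul_of_one_le_right (by positivity) (Real.one_le_exp (by positivity))

lemma abs_le_of_c2Norm_eq {L : ℝ≥0} (h : c2Norm a = (L : ℝ≥0∞)) (x : E d) : |a x| ≤ L := by
  have h1 : ‖a x‖ₑ ≤ c2Norm a := by
    have h2 : ‖iteratedFDeriv ℝ 0 a x (fun j => EuclideanSpace.single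
        ((Fin.elim0 : Fin 0 → Fin d) j) (1 : ℝ))‖ₑ ≤ c2Norm a :=
      le_iSup₂_of_le 0 (Nat.zero_le 2) (le_iSup₂_of_le Fin.elim0 x le_rfl)
    simpa using h2
  rw [h, ← ofReal_norm] at h1
  simpa using (ENNReal.ofReal_le_iff_le_toReal ENNReal.coe_ne_top).1 h1

end Target

/-! ### The loss: growth, integrability and relation to the marginal error. -/

section Loss

variable {smin : ℝ}

/-- The integrand of the loss as a function on space-time times the data space. -/
noncomputable def lossIntegrand (smin : ℝ) (w : VField d) (q : (I × E d) × E d) : ℝ :=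
  ‖w q.1 - condField smin q.1.1 q.2 q.1.2‖ ^ 2 * condDensity smin q.1.1 q.2 q.1.2

lemma continuous_lossIntegrand (hs : 0 < smin) (w : VField d) :
    Continuous (lossIntegrand smin w) := by
  have hφ : Continuous fun q : (I × E d) × E d => (((q.1.1 : ℝ), q.1.2), q.2) := by fun_prop
  have h1 := (continuous_condDensity hs).comp hφ
  have h2 := (continuous_condField hs).comp hφ
  have h3 : Continuous fun q : (I × E d) × E d => w q.1 := by fun_prop
  exact ((h3.sub h2).norm.pow 2).mul h1

lemma lossIntegrand_nonneg (hs : 0 < smin) (w : VField d) (q : (I × E d) × E d) :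
    0 ≤ lossIntegrand smin w q :=
  mul_nonneg (by positivity) (condDensity_pos hs _ _ _).le

lemma sq_norm_add_le {F : Type*} [SeminormedAddCommGroup F] (u v : F) :
    ‖u + v‖ ^ 2 ≤ 2 * ‖u‖ ^ 2 + 2 * ‖v‖ ^ 2 := by
  have h := norm_add_le u v
  nlinarith [sq_nonneg (‖u‖ - ‖v‖), norm_nonneg (u + v)]

/-- Since `v_t(x | y) = log σ_min (x - t y) + y`, the integrand is controlled by the mass and the
centred second moment of a Gaussian, both explicit. -/
lemma lossIntegrand_le (hs : 0 < smin) {w : VField d} {W : ℝ} (hw : ∀ q, ‖w q‖ ^ 2 ≤ W)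
    (t : I) (x y : E d) :
    lossIntegrand smin w ((t, x), y) ≤ (2 * W + 4 * ‖y‖ ^ 2) * condDensity smin t y x +
      4 * Real.log smin ^ 2 * (‖x - (t : ℝ) • y‖ ^ 2 * condDensity smin t y x) := by
  have h1 := sq_norm_add_le (w (t, x)) (-condField smin t y x)
  have h2 := sq_norm_add_le (Real.log smin • (x - (t : ℝ) • y)) y
  rw [← condField_eq hs, norm_smul, mul_pow, Real.norm_eq_abs, sq_abs] at h2
  rw [norm_neg, ← sub_eq_add_neg] at h1
  have h3 := hw (t, x)
  have h4 := condDensity_pos hs (t : ℝ) y x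
  simp only [lossIntegrand]
  calc _ ≤ (2 * W + 4 * ‖y‖ ^ 2 + 4 * Real.log smin ^ 2 * ‖x - (t : ℝ) • y‖ ^ 2) *
        condDensity smin t y x := by gcongr; linarith
    _ = _ := by ring

lemma integrable_lossIntegrand_space (hs : 0 < smin) {w : VField d} {W : ℝ}
    (hw : ∀ q, ‖w q‖ ^ 2 ≤ W) (t : I) (y : E d) :
    Integrable fun x => lossIntegrand smin w ((t, x), y) := by
  refine (((integrable_condDensity hs (t : ℝ) y).const_mul (2 * W + 4 * ‖y‖ ^ 2)).add
    ((integrable_sq_norm_sub_mul_condDensity hs (t : ℝ) y).const_mul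
      (4 * Real.log smin ^ 2))).mono' ?_ (Filter.Eventually.of_forall fun x => ?_)
  · exact ((continuous_lossIntegrand hs w).comp (by fun_prop)).aestronglyMeasurable
  · rw [Real.norm_of_nonneg (lossIntegrand_nonneg hs w _)]
    exact lossIntegrand_le hs hw t x y

lemma integral_lossIntegrand_space_le (hs : 0 < smin) (hs1 : smin ≤ 1) {w : VField d} {W : ℝ}
    (hw : ∀ q, ‖w q‖ ^ 2 ≤ W) (t : I) (y : E d) :
    ∫ x, lossIntegrand smin w ((t, x), y) ≤
      2 * W + 4 * ‖y‖ ^ 2 + 4 * Real.log smin ^ 2 * gaussianSecondMoment d := by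
  have h1 := (integrable_condDensity hs (t : ℝ) y).const_mul (2 * W + 4 * ‖y‖ ^ 2)
  have h2 := (integrable_sq_norm_sub_mul_condDensity hs (t : ℝ) y).const_mul
      (4 * Real.log smin ^ 2)
  refine (integral_mono (integrable_lossIntegrand_space hs hw t y) (h1.add h2)
    fun x => lossIntegrand_le hs hw t x y).trans ?_
  simp only [Pi.add_apply]
  rw [integral_add h1 h2, integral_const_mul, integral_const_mul, integral_condDensity hs,
    integral_sq_norm_sub_mul_condDensity hs, mul_one]
  -- `σ_t ≤ 1` makes the bound uniform in `t`.
  have h3 := stdDev_le_one hs hs1 t.2.1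
  have h4 := stdDev_pos hs (t : ℝ)
  have h5 := gaussianSecondMoment_nonneg d
  gcongr
  exact mul_le_of_le_one_left h5 (pow_le_one₀ h4.le h3)

lemma integrable_lossIntegrand_spacetime (hs : 0 < smin) (hs1 : smin ≤ 1) {w : VField d} {W : ℝ}
    (hw : ∀ q, ‖w q‖ ^ 2 ≤ W) (y : E d) :
    Integrable (fun p : I × E d => lossIntegrand smin w (p, y)) := by
  have hm : AEStronglyMeasurable (fun p : I × E d => lossIntegrand smin w (p, y))
      ((volume : Measure I).prod (volume : Measure (E d))) :=
    ((continuous_lossIntegrand hs w).comp (by fun_prop)).aestronglyMeasurable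
  rw [Measure.volume_eq_prod, integrable_prod_iff hm]
  refine ⟨Filter.Eventually.of_forall fun t => integrable_lossIntegrand_space hs hw t y, ?_⟩
  refine (integrable_const (2 * W + 4 * ‖y‖ ^ 2 +
    4 * Real.log smin ^ 2 * gaussianSecondMoment d)).mono' hm.norm.integral_prod_right'
    (Filter.Eventually.of_forall fun t => ?_)
  simp only [Real.norm_of_nonneg (lossIntegrand_nonneg hs w _)]
  rw [Real.norm_of_nonneg (integral_nonneg fun x => lossIntegrand_nonneg hs w _)]
  exact integral_lossIntegrand_space_le hs hs1 hw t y

lemma loss_eq_integral (hs : 0 < smin) (hs1 : smin ≤ 1) {w : VField d} {W : ℝ}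
    (hw : ∀ q, ‖w q‖ ^ 2 ≤ W) (y : E d) :
    loss smin w y = ∫ p : I × E d, lossIntegrand smin w (p, y) := by
  have h := integrable_lossIntegrand_spacetime hs hs1 hw y
  rw [Measure.volume_eq_prod] at h ⊢
  rw [integral_prod _ h]
  rfl

lemma loss_nonneg (hs : 0 < smin) (w : VField d) (y : E d) : 0 ≤ loss smin w y :=
  integral_nonneg fun _ => integral_nonneg fun _ =>
    mul_nonneg (by positivity) (condDensity_pos hs _ _ _).le

lemma loss_le (hs : 0 < smin) (hs1 : smin ≤ 1) {w : VField d} {W : ℝ}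
    (hw : ∀ q, ‖w q‖ ^ 2 ≤ W) (y : E d) :
    loss smin w y ≤ 2 * W + 4 * ‖y‖ ^ 2 + 4 * Real.log smin ^ 2 * gaussianSecondMoment d := by
  have h := integrable_lossIntegrand_spacetime hs hs1 hw y
  rw [Measure.volume_eq_prod] at h
  calc loss smin w y
      ≤ ∫ _ : I, (2 * W + 4 * ‖y‖ ^ 2 + 4 * Real.log smin ^ 2 * gaussianSecondMoment d) :=
        integral_mono h.integral_prod_left (integrable_const _)
          fun t => integral_lossIntegrand_space_le hs hs1 hw t y
    _ = _ := by simp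

lemma measurable_loss (hs : 0 < smin) (hs1 : smin ≤ 1) {w : VField d} {W : ℝ}
    (hw : ∀ q, ‖w q‖ ^ 2 ≤ W) : Measurable (loss smin w) := by
  have h : loss smin w = fun y => ∫ p : I × E d, lossIntegrand smin w (p, y) :=
    funext fun y => loss_eq_integral hs hs1 hw y
  rw [h]
  exact (StronglyMeasurable.integral_prod_left'
    (continuous_lossIntegrand hs w).stronglyMeasurable).measurable

variable {a : E d → ℝ} {L : ℝ}

/-- By Tonelli, integrating out space-time first leaves the loss, which is at most quadratic in `y`,
and the target has a second moment. -/
lemma integrable_lossIntegrand (hs : 0 < smin) (hs1 : smin ≤ 1) {w : VField d} {W : ℝ}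
    (hw : ∀ q, ‖w q‖ ^ 2 ≤ W) (ha : Continuous a) (hL : ∀ x, |a x| ≤ L) :
    Integrable (lossIntegrand smin w)
      ((volume : Measure (I × E d)).prod (targetMeasure a)) := by
  have := isProbabilityMeasure_targetMeasure ha hL
  have hm : AEStronglyMeasurable (lossIntegrand smin w)
      ((volume : Measure (I × E d)).prod (targetMeasure a)) :=
    (continuous_lossIntegrand hs w).aestronglyMeasurable
  rw [integrable_prod_iff' hm]
  refine ⟨Filter.Eventually.of_forall fun y => integrable_lossIntegrand_spacetime hs hs1 hw y, ?_⟩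
  simp only [Real.norm_of_nonneg (lossIntegrand_nonneg hs w _), ← loss_eq_integral hs hs1 hw]
  have hW : 0 ≤ W := le_trans (by positivity) (hw (0, 0))
  have hG := gaussianSecondMoment_nonneg d
  refine ((integrable_one_add_sq_norm_targetMeasure ha hL).const_mul
    (2 * W + 4 + 4 * Real.log smin ^ 2 * gaussianSecondMoment d)).mono'
    (measurable_loss hs hs1 hw).aestronglyMeasurable (Filter.Eventually.of_forall fun y => ?_)
  rw [Real.norm_of_nonneg (loss_nonneg hs w y)]
  refine (loss_le hs hs1 hw y).trans ?_
  have h1 : 0 ≤ (2 * W + 4 * Real.log smin ^ 2 * gaussianSecondMoment d) * ‖y‖ ^ 2 := by positivity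
  nlinarith

lemma integrable_loss (hs : 0 < smin) (hs1 : smin ≤ 1) {w : VField d} {W : ℝ}
    (hw : ∀ q, ‖w q‖ ^ 2 ≤ W) (ha : Continuous a) (hL : ∀ x, |a x| ≤ L) :
    Integrable (loss smin w) (targetMeasure a) := by
  have := isProbabilityMeasure_targetMeasure ha hL
  refine (integrable_lossIntegrand hs hs1 hw ha hL).integral_prod_right.congr
    (Filter.Eventually.of_forall fun y => ?_)
  exact (loss_eq_integral hs hs1 hw y).symm

/-! ### The marginal field as a posterior mean. -/

lemma margDensity_eq (ha : Continuous a) (t : ℝ) (x : E d) :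
    margDensity a smin t x = ∫ y, condDensity smin t y x ∂(targetMeasure a) := by
  rw [integral_targetMeasure ha, margDensity]
  simp only [smul_eq_mul, mul_comm]

lemma margField_eq (ha : Continuous a) (t : ℝ) (x : E d) :
    margField a smin t x = (margDensity a smin t x)⁻¹ •
      ∫ y, condDensity smin t y x • condField smin t y x ∂(targetMeasure a) := by
  rw [integral_targetMeasure ha, margField, ← integral_smul]
  refine integral_congr_ae (Filter.Eventually.of_forall fun y => ?_)
  simp only [smul_smul]
  congr 1
  ring

lemma integrable_condDensity_targetMeasure (hs : 0 < smin) (ha : Continuous a)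
    (hL : ∀ x, |a x| ≤ L) (t : ℝ) (x : E d) :
    Integrable (fun y => condDensity smin t y x) (targetMeasure a) := by
  have := isProbabilityMeasure_targetMeasure ha hL
  refine (integrable_const (stdDev smin t ^ d * gaussianMass d)⁻¹).mono'
    ((continuous_condDensity hs).comp
      (by fun_prop : Continuous fun y : E d => ((t, x), y))).aestronglyMeasurable
    (Filter.Eventually.of_forall fun y => ?_)
  rw [Real.norm_of_nonneg (condDensity_pos hs t y x).le]
  exact condDensity_le hs t y x

lemma margDensity_pos (hs : 0 < smin) (ha : Continuous a) (hL : ∀ x, |a x| ≤ L) (t : ℝ)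
    (x : E d) : 0 < margDensity a smin t x := by
  have := isProbabilityMeasure_targetMeasure ha hL
  rw [margDensity_eq ha, integral_pos_iff_support_of_nonneg
    (fun y => (condDensity_pos hs t y x).le) (integrable_condDensity_targetMeasure hs ha hL t x)]
  have : Function.support (fun y => condDensity smin t y x) = Set.univ :=
    Set.eq_univ_of_forall fun y => (condDensity_pos hs t y x).ne'
  rw [this, measure_univ]
  exact one_pos

lemma sq_norm_condField_le (hs : 0 < smin) (t : ℝ) (x y : E d) :
    ‖condField smin t y x‖ ^ 2 ≤
      (4 * Real.log smin ^ 2 * ‖x‖ ^ 2 + 4 * Real.log smin ^ 2 * t ^ 2 + 2) * (1 + ‖y‖ ^ 2) := by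
  rw [condField_eq hs]
  have h1 := sq_norm_add_le (Real.log smin • (x - t • y)) y
  have h2 := sq_norm_add_le x (-(t • y))
  rw [norm_smul, mul_pow, Real.norm_eq_abs, sq_abs] at h1
  rw [norm_neg, norm_smul, mul_pow, Real.norm_eq_abs, sq_abs, ← sub_eq_add_neg] at h2
  have h3 := mul_le_mul_of_nonneg_left h2 (sq_nonneg (Real.log smin))
  have h4 : 0 ≤ Real.log smin ^ 2 * ‖x‖ ^ 2 * ‖y‖ ^ 2 := by positivity
  have h5 : 0 ≤ Real.log smin ^ 2 * t ^ 2 := by positivity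
  nlinarith

lemma integrable_condDensity_mul_sq_norm_condField (hs : 0 < smin) (ha : Continuous a)
    (hL : ∀ x, |a x| ≤ L) (t : ℝ) (x : E d) :
    Integrable (fun y => condDensity smin t y x * ‖condField smin t y x‖ ^ 2)
      (targetMeasure a) := by
  have hφ : Continuous fun y : E d => ((t, x), y) := by fun_prop
  refine ((integrable_one_add_sq_norm_targetMeasure ha hL).const_mul
    ((stdDev smin t ^ d * gaussianMass d)⁻¹ *
      (4 * Real.log smin ^ 2 * ‖x‖ ^ 2 + 4 * Real.log smin ^ 2 * t ^ 2 + 2))).mono'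
    (((continuous_condDensity hs).comp hφ).mul
      (((continuous_condField hs).comp hφ).norm.pow 2)).aestronglyMeasurable
    (Filter.Eventually.of_forall fun y => ?_)
  have h1 := condDensity_pos hs t y x
  rw [Real.norm_of_nonneg (by positivity), mul_assoc]
  exact mul_le_mul (condDensity_le hs t y x) (sq_norm_condField_le hs t x y) (by positivity)
    (h1.le.trans (condDensity_le hs t y x))

lemma integrable_condDensity_smul_condField (hs : 0 < smin) (ha : Continuous a)
    (hL : ∀ x, |a x| ≤ L) (t : ℝ) (x : E d) :
    Integrable (fun y => condDensity smin t y x • condField smin t y x) (targetMeasure a) := by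
  have hφ : Continuous fun y : E d => ((t, x), y) := by fun_prop
  refine ((integrable_condDensity_targetMeasure hs ha hL t x).add
    (integrable_condDensity_mul_sq_norm_condField hs ha hL t x)).mono'
    (((continuous_condDensity hs).comp hφ).smul
      ((continuous_condField hs).comp hφ)).aestronglyMeasurable
    (Filter.Eventually.of_forall fun y => ?_)
  have h1 := condDensity_pos hs t y x
  rw [norm_smul, Real.norm_of_nonneg h1.le]
  simp only [Pi.add_apply]
  -- This is `‖v‖ ≤ 1 + ‖v‖ ^ 2`, weighted by the density.
  nlinarith [sq_nonneg (‖condField smin t y x‖ - 1), norm_nonneg (condField smin t y x),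
    mul_nonneg h1.le (sq_nonneg (‖condField smin t y x‖ - 1 / 2))]

/-- The bias-variance decomposition at a fixed space-time point; positivity of `p_t(x)` identifies
the marginal field as the weighted mean. -/
lemma integral_lossIntegrand_targetMeasure (hs : 0 < smin) (ha : Continuous a)
    (hL : ∀ x, |a x| ≤ L) (w : VField d) (t : I) (x : E d) :
    ∫ y, lossIntegrand smin w ((t, x), y) ∂(targetMeasure a) =
      ‖w (t, x) - margField a smin t x‖ ^ 2 * margDensity a smin t x +
      ∫ y, ‖margField a smin t x - condField smin t y x‖ ^ 2 * condDensity smin t y x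
        ∂(targetMeasure a) := by
  have hp := margDensity_pos hs ha hL (t : ℝ) x
  have h := integral_mul_sq_norm_sub_eq (integrable_condDensity_targetMeasure hs ha hL (t : ℝ) x)
    (integrable_condDensity_smul_condField hs ha hL (t : ℝ) x)
    (integrable_condDensity_mul_sq_norm_condField hs ha hL (t : ℝ) x)
    (w (t, x)) (margField a smin t x) (by
      rw [← margDensity_eq ha, margField_eq ha, smul_smul, mul_inv_cancel₀ hp.ne', one_smul])
  rw [← margDensity_eq ha] at h
  exact h

lemma measurable_margDensity (hs : 0 < smin) (ha : Continuous a) (hL : ∀ x, |a x| ≤ L) :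
    Measurable fun p : I × E d => margDensity a smin p.1 p.2 := by
  have := isProbabilityMeasure_targetMeasure ha hL
  simp only [margDensity_eq ha]
  have hφ : Continuous fun q : (I × E d) × E d => (((q.1.1 : ℝ), q.1.2), q.2) := by fun_prop
  exact (StronglyMeasurable.integral_prod_right'
    ((continuous_condDensity hs).comp hφ).stronglyMeasurable).measurable

lemma measurable_margField (hs : 0 < smin) (ha : Continuous a) (hL : ∀ x, |a x| ≤ L) :
    Measurable fun p : I × E d => margField a smin p.1 p.2 := by
  have := isProbabilityMeasure_targetMeasure ha hL
  simp only [margField_eq ha]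
  have hφ : Continuous fun q : (I × E d) × E d => (((q.1.1 : ℝ), q.1.2), q.2) := by fun_prop
  refine (measurable_margDensity hs ha hL).inv.smul ?_
  exact (StronglyMeasurable.integral_prod_right' (((continuous_condDensity hs).comp hφ).smul
    ((continuous_condField hs).comp hφ)).stronglyMeasurable).measurable

/-- The part of the expected loss that does not depend on the vector field. -/
noncomputable def lossVariance (a : E d → ℝ) (smin : ℝ) : ℝ :=
  ∫ p : I × E d, ∫ y, ‖margField a smin p.1 p.2 - condField smin p.1 y p.2‖ ^ 2 *
    condDensity smin p.1 y p.2 ∂(targetMeasure a)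

/-- The expected conditional loss and the marginal error differ by a constant. -/
lemma integral_loss_eq (hs : 0 < smin) (hs1 : smin ≤ 1) {w : VField d} {W : ℝ}
    (hw : ∀ q, ‖w q‖ ^ 2 ≤ W) (ha : Continuous a) (hL : ∀ x, |a x| ≤ L) :
    ∫ y, loss smin w y ∂(targetMeasure a) = fmError a smin w + lossVariance a smin := by
  have := isProbabilityMeasure_targetMeasure ha hL
  have hG := integrable_lossIntegrand hs hs1 hw ha hL
  have hH := hG.integral_prod_left
  have hsplit : ∀ p : I × E d, ∫ y, lossIntegrand smin w (p, y) ∂(targetMeasure a) =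
      ‖w p - margField a smin p.1 p.2‖ ^ 2 * margDensity a smin p.1 p.2 +
      ∫ y, ‖margField a smin p.1 p.2 - condField smin p.1 y p.2‖ ^ 2 *
        condDensity smin p.1 y p.2 ∂(targetMeasure a) :=
    fun p => integral_lossIntegrand_targetMeasure hs ha hL w p.1 p.2
  have hR : ∀ p : I × E d, 0 ≤ ∫ y, ‖margField a smin p.1 p.2 - condField smin p.1 y p.2‖ ^ 2 *
        condDensity smin p.1 y p.2 ∂(targetMeasure a) := fun p =>
    integral_nonneg fun y => mul_nonneg (by positivity) (condDensity_pos hs _ _ _).le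
  have hA : ∀ p : I × E d,
      0 ≤ ‖w p - margField a smin p.1 p.2‖ ^ 2 * margDensity a smin p.1 p.2 := fun p =>
    mul_nonneg (by positivity) (margDensity_pos hs ha hL _ _).le
  have hiA : Integrable fun p : I × E d =>
      ‖w p - margField a smin p.1 p.2‖ ^ 2 * margDensity a smin p.1 p.2 := by
    refine hH.mono' ?_ (Filter.Eventually.of_forall fun p => ?_)
    · exact (((w.continuous.measurable.sub (measurable_margField hs ha hL)).norm.pow_const 2).mul
        (measurable_margDensity hs ha hL)).aestronglyMeasurable
    · rw [Real.norm_of_nonneg (hA p), hsplit p]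
      linarith [hR p]
  -- The variance term is integrable as the difference of two integrable functions, without a bound
  -- of its own.
  have hiR := (hH.sub hiA).congr (Filter.Eventually.of_forall fun p => by
    simp only [Pi.sub_apply]
    exact sub_eq_of_eq_add' (hsplit p))
  have hfm : fmError a smin w = ∫ p : I × E d,
      ‖w p - margField a smin p.1 p.2‖ ^ 2 * margDensity a smin p.1 p.2 := by
    rw [Measure.volume_eq_prod] at hiA ⊢
    rw [integral_prod _ hiA]
    rfl
  rw [hfm, lossVariance, ← integral_add hiA hiR]
  simp only [loss_eq_integral hs hs1 hw, ← hsplit]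
  exact (integral_integral_swap
    (f := fun (p : I × E d) (y : E d) => lossIntegrand smin w (p, y)) hG).symm

lemma fmError_nonneg (hs : 0 < smin) (ha : Continuous a) (hL : ∀ x, |a x| ≤ L) (w : VField d) :
    0 ≤ fmError a smin w :=
  integral_nonneg fun _ => integral_nonneg fun _ =>
    mul_nonneg (by positivity) (margDensity_pos hs ha hL _ _).le

end Loss

/-! ### Concentration and the oracle comparison. -/

section Concentration

variable {Ω S : Type*} [MeasurableSpace Ω] [MeasurableSpace S] {P : Measure Ω}
  [IsProbabilityMeasure P] {ν : Measure S} {n : ℕ} {X : Fin n → Ω → S}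

/-- One-sided Hoeffding inequality for a sample and a bounded function. -/
lemma measure_sum_sub_integral_ge_le (hX : ∀ i, Measurable (X i)) (hind : iIndepFun X P)
    (hlaw : ∀ i, P.map (X i) = ν) {φ : S → ℝ} (hφ : Measurable φ) {l u : ℝ}
    (hl : ∀ y, φ y ∈ Set.Icc l u) {s : ℝ} (hs : 0 ≤ s) :
    P.real {ω | n * s ≤ ∑ i, φ (X i ω) - n * ∫ y, φ y ∂ν} ≤
      Real.exp (-(2 * n * s ^ 2 / (u - l) ^ 2)) := by
  have hint : ∀ i, P[fun ω => φ (X i ω)] = ∫ y, φ y ∂ν := fun i => by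
    rw [← hlaw i, integral_map (hX i).aemeasurable hφ.aestronglyMeasurable]
  have hsub : ∀ i ∈ Finset.univ, HasSubgaussianMGF (fun ω => φ (X i ω) - ∫ y, φ y ∂ν)
      ((‖u - l‖₊ / 2) ^ 2) P := fun i _ => by
    rw [← hint i]
    exact hasSubgaussianMGF_of_mem_Icc (hφ.comp (hX i)).aemeasurable
      (Filter.Eventually.of_forall fun ω => hl _)
  have hind' : iIndepFun (fun i ω => φ (X i ω) - ∫ y, φ y ∂ν) P :=
    hind.comp (fun _ y => φ y - ∫ y, φ y ∂ν) fun _ => hφ.sub_const _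
  have h := HasSubgaussianMGF.measure_sum_ge_le_of_iIndepFun hind' hsub (ε := n * s)
    (by positivity)
  simp only [Finset.sum_sub_distrib, Finset.sum_const, Finset.card_univ, Fintype.card_fin,
    nsmul_eq_mul] at h
  refine h.trans (le_of_eq ?_)
  congr 1
  push_cast
  rw [Real.norm_eq_abs, div_pow, sq_abs]
  -- In the two degenerate cases both exponents vanish, since division by zero gives zero.
  by_cases hn : (n : ℝ) = 0
  · simp [hn]
  by_cases hul : u - l = 0
  · simp [hul]
  field_simp

lemma measure_abs_sum_sub_integral_ge_le (hX : ∀ i, Measurable (X i)) (hind : iIndepFun X P)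
    (hlaw : ∀ i, P.map (X i) = ν) {φ : S → ℝ} (hφ : Measurable φ) {b : ℝ}
    (hb : ∀ y, φ y ∈ Set.Icc 0 b) {s : ℝ} (hs : 0 ≤ s) :
    P {ω | n * s ≤ |∑ i, φ (X i ω) - n * ∫ y, φ y ∂ν|} ≤
      ENNReal.ofReal (2 * Real.exp (-(2 * n * s ^ 2 / b ^ 2))) := by
  have h1 := measure_sum_sub_integral_ge_le hX hind hlaw hφ hb hs
  have h2 := measure_sum_sub_integral_ge_le hX hind hlaw (φ := fun y => -φ y) hφ.neg
    (l := -b) (u := 0) (fun y => ⟨neg_le_neg (hb y).2, neg_nonpos.2 (hb y).1⟩) hs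
  simp only [sub_zero, zero_sub, neg_neg, integral_neg, Finset.sum_neg_distrib] at h1 h2
  have hsub : {ω | n * s ≤ |∑ i, φ (X i ω) - n * ∫ y, φ y ∂ν|} ⊆
      {ω | n * s ≤ ∑ i, φ (X i ω) - n * ∫ y, φ y ∂ν} ∪
      {ω | n * s ≤ -∑ i, φ (X i ω) - n * -∫ y, φ y ∂ν} := fun ω hω => by
    have hω' : n * s ≤ |∑ i, φ (X i ω) - n * ∫ y, φ y ∂ν| := hω
    rcases le_abs.1 hω' with h | h
    · exact Or.inl h
    · refine Or.inr ?_
      change n * s ≤ -∑ i, φ (X i ω) - n * -∫ y, φ y ∂ν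
      linarith
  refine (ENNReal.le_ofReal_iff_toReal_le (measure_ne_top _ _) (by positivity)).2 ?_
  calc _ ≤ _ := measureReal_mono hsub
    _ ≤ _ := measureReal_union_le _ _
    _ ≤ _ := by rw [two_mul]; exact add_le_add h1 h2

lemma measure_exists_abs_sum_sub_integral_ge_le {ι : Type*} (T : Finset ι)
    (hX : ∀ i, Measurable (X i)) (hind : iIndepFun X P) (hlaw : ∀ i, P.map (X i) = ν)
    {φ : ι → S → ℝ} (hφ : ∀ k ∈ T, Measurable (φ k)) {b : ℝ}
    (hb : ∀ k ∈ T, ∀ y, φ k y ∈ Set.Icc 0 b) {s : ℝ} (hs : 0 ≤ s) :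
    P {ω | ∃ k ∈ T, n * s ≤ |∑ i, φ k (X i ω) - n * ∫ y, φ k y ∂ν|} ≤
      ENNReal.ofReal (T.card * (2 * Real.exp (-(2 * n * s ^ 2 / b ^ 2)))) := by
  have h : {ω | ∃ k ∈ T, n * s ≤ |∑ i, φ k (X i ω) - n * ∫ y, φ k y ∂ν|} =
      ⋃ k ∈ T, {ω | n * s ≤ |∑ i, φ k (X i ω) - n * ∫ y, φ k y ∂ν|} := by
    ext ω; simp
  rw [h]
  refine (measure_biUnion_finset_le _ _).trans ((Finset.sum_le_sum fun k hk =>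
    measure_abs_sum_sub_integral_ge_le hX hind hlaw (hφ k hk) (hb k hk) hs).trans ?_)
  rw [Finset.sum_const, nsmul_eq_mul, ENNReal.ofReal_mul (Nat.cast_nonneg _),
    ENNReal.ofReal_natCast]

lemma setIntegral_le_of_abs_sub_le [IsProbabilityMeasure ν] {Q : Set S} (hQ : MeasurableSet Q)
    {f g : S → ℝ} (hf : Integrable f ν) (hg : Integrable g ν) {δ : ℝ} (hδ : 0 ≤ δ)
    (h : ∀ y ∈ Q, |f y - g y| ≤ δ) : ∫ y in Q, f y ∂ν ≤ ∫ y in Q, g y ∂ν + δ := by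
  calc ∫ y in Q, f y ∂ν ≤ ∫ y in Q, (g y + δ) ∂ν :=
        setIntegral_mono_on hf.integrableOn (hg.add (integrable_const δ)).integrableOn hQ
          fun y hy => by linarith [le_abs_self (f y - g y), h y hy]
    _ = ∫ y in Q, g y ∂ν + ν.real Q * δ := by
        rw [integral_add hg.integrableOn (integrable_const δ)]
        simp
    _ ≤ _ := by
        gcongr
        exact mul_le_of_le_one_left hδ measureReal_le_one

/-- The deterministic comparison behind an oracle inequality for empirical risk minimisation:
`f'` and `g'` are members of a cover near `f` and `g` on the set `Q` containing the sample. -/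
lemma integral_le_of_sum_le [IsProbabilityMeasure ν] (hn : 0 < n) {Q : Set S}
    (hQ : MeasurableSet Q) {y : Fin n → S} (hy : ∀ i, y i ∈ Q) {f g f' g' : S → ℝ}
    (hf : Integrable f ν) (hg : Integrable g ν) (hf' : Integrable f' ν) (hg' : Integrable g' ν)
    (hg0 : ∀ y, 0 ≤ g y) {η δ s : ℝ} (hδ : 0 ≤ δ) (hη : ∫ y in Qᶜ, f y ∂ν ≤ η)
    (hff' : ∀ y ∈ Q, |f y - f' y| ≤ δ) (hgg' : ∀ y ∈ Q, |g y - g' y| ≤ δ)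
    (hdf : |∑ i, Q.indicator f' (y i) - n * ∫ y, Q.indicator f' y ∂ν| ≤ n * s)
    (hdg : |∑ i, Q.indicator g' (y i) - n * ∫ y, Q.indicator g' y ∂ν| ≤ n * s)
    (hmin : ∑ i, f (y i) ≤ ∑ i, g (y i)) :
    ∫ y, f y ∂ν ≤ ∫ y, g y ∂ν + 2 * s + 4 * δ + η := by
  simp only [Set.indicator_of_mem (hy _), integral_indicator hQ] at hdf hdg
  have h1 := integral_add_compl hQ hf
  have h2 := integral_add_compl hQ hg
  have h3 : 0 ≤ ∫ y in Qᶜ, g y ∂ν := integral_nonneg hg0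
  have h4 := setIntegral_le_of_abs_sub_le hQ hf hf' hδ hff'
  have h5 := setIntegral_le_of_abs_sub_le hQ hg' hg hδ fun y hy => by
    rw [abs_sub_comm]; exact hgg' y hy
  have h6 : ∑ i, f' (y i) ≤ ∑ i, f (y i) + n * δ := by
    have : ∑ i, f' (y i) ≤ ∑ i, (f (y i) + δ) := Finset.sum_le_sum fun i _ => by
      linarith [neg_abs_le (f (y i) - f' (y i)), hff' _ (hy i)]
    simpa [Finset.sum_add_distrib] using this
  have h7 : ∑ i, g (y i) ≤ ∑ i, g' (y i) + n * δ := by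
    have : ∑ i, g (y i) ≤ ∑ i, (g' (y i) + δ) := Finset.sum_le_sum fun i _ => by
      linarith [le_abs_self (g (y i) - g' (y i)), hgg' _ (hy i)]
    simpa [Finset.sum_add_distrib] using this
  have hn' : (0 : ℝ) < n := Nat.cast_pos.2 hn
  -- The chain runs from `f'` in mean to `f'` on the sample, `f`, `g`, `g'` on the sample, and `g'`
  -- in mean: two deviations and two cover errors. Two further cover errors, from `h4` and `h5`,
  -- return to `f` and `g`. Off `Q`, `g` is dropped by sign and `f` costs `η`.
  have h8 : n * ∫ y in Q, f' y ∂ν ≤ n * (∫ y in Q, g' y ∂ν + 2 * s + 2 * δ) := by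
    have := (abs_le.1 hdf).1
    have := (abs_le.1 hdg).2
    linarith
  have h9 := le_of_mul_le_mul_left h8 hn'
  linarith

end Concentration

/-! ### Truncation to the cube. -/

lemma measurableSet_logCube (d n : ℕ) : MeasurableSet (logCube d n) := by
  have : logCube d n = ⋂ j, {y : E d | |y j| ≤ Real.log n} := by
    ext y; simp [logCube]
  rw [this]
  exact (isClosed_iInter fun j => isClosed_le (by fun_prop) continuous_const).measurableSet

lemma sq_norm_le_of_mem_logCube {n : ℕ} {y : E d} (hy : y ∈ logCube d n) :
    ‖y‖ ^ 2 ≤ d * Real.log n ^ 2 := by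
  rw [EuclideanSpace.norm_sq_eq]
  calc ∑ j, ‖y j‖ ^ 2 ≤ ∑ _j : Fin d, Real.log n ^ 2 :=
        Finset.sum_le_sum fun j _ => pow_le_pow_left₀ (norm_nonneg _) (hy j) 2
    _ = _ := by simp

lemma sq_log_le_of_notMem_logCube {n : ℕ} {y : E d} (hy : y ∉ logCube d n) :
    Real.log n ^ 2 ≤ ‖y‖ ^ 2 := by
  obtain ⟨j, hj⟩ : ∃ j, Real.log n < |y j| := by simpa [logCube] using hy
  exact pow_le_pow_left₀ (Real.log_natCast_nonneg n)
    (hj.le.trans (EuclideanSpace.norm_eq y ▸ by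
      simpa [EuclideanSpace.norm_eq] using PiLp.norm_apply_le y j)) 2

/-- The constant in the tail bound for the target distribution. -/
noncomputable def tailConst (d : ℕ) (L : ℝ) : ℝ :=
  Real.exp (2 * L) / gaussianMass d * ∫ y : E d, (1 + ‖y‖ ^ 2) * Real.exp (-(1 / 4 * ‖y‖ ^ 2))

lemma tailConst_nonneg (d : ℕ) (L : ℝ) : 0 ≤ tailConst d L :=
  mul_nonneg (div_nonneg (Real.exp_pos _).le (gaussianMass_pos d).le)
    (integral_nonneg fun _ => by positivity)

/-- Chernoff's argument: outside the cube `‖y‖ ≥ log n`, so `1 ≤ exp (-log(n)^2 / 4) * exp (‖y‖ ^ 2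
/ 4)`. -/
lemma setIntegral_compl_logCube_le {a : E d → ℝ} {L : ℝ} (ha : Continuous a)
    (hL : ∀ x, |a x| ≤ L) (n : ℕ) :
    ∫ y in (logCube d n)ᶜ, (1 + ‖y‖ ^ 2) ∂(targetMeasure a) ≤
      tailConst d L * Real.exp (-(Real.log n ^ 2 / 4)) := by
  obtain ⟨hi, hle⟩ := integrable_one_add_sq_norm_mul_exp_targetMeasure ha hL
  calc ∫ y in (logCube d n)ᶜ, (1 + ‖y‖ ^ 2) ∂(targetMeasure a)
      ≤ ∫ y in (logCube d n)ᶜ, Real.exp (-(Real.log n ^ 2 / 4)) *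
          ((1 + ‖y‖ ^ 2) * Real.exp (‖y‖ ^ 2 / 4)) ∂(targetMeasure a) := by
        refine setIntegral_mono_on (integrable_one_add_sq_norm_targetMeasure ha hL).integrableOn
          (hi.const_mul _).integrableOn (measurableSet_logCube d n).compl fun y hy => ?_
        rw [mul_left_comm, ← Real.exp_add]
        refine le_mul_of_one_le_right (by positivity) (Real.one_le_exp ?_)
        linarith [sq_log_le_of_notMem_logCube hy]
    _ ≤ ∫ y, Real.exp (-(Real.log n ^ 2 / 4)) *
          ((1 + ‖y‖ ^ 2) * Real.exp (‖y‖ ^ 2 / 4)) ∂(targetMeasure a) :=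
        setIntegral_le_integral (hi.const_mul _)
          (Filter.Eventually.of_forall fun y => by
            simp only [Pi.zero_apply]; positivity)
    _ ≤ _ := by
        rw [integral_const_mul, mul_comm]
        exact mul_le_mul_of_nonneg_right hle (Real.exp_pos _).le

lemma measureReal_compl_logCube_le {a : E d → ℝ} {L : ℝ} (ha : Continuous a)
    (hL : ∀ x, |a x| ≤ L) (n : ℕ) :
    (targetMeasure a).real (logCube d n)ᶜ ≤
      tailConst d L * Real.exp (-(Real.log n ^ 2 / 4)) := by
  have := isProbabilityMeasure_targetMeasure ha hL
  refine le_trans ?_ (setIntegral_compl_logCube_le ha hL n)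
  calc (targetMeasure a).real (logCube d n)ᶜ
      = ∫ _ in (logCube d n)ᶜ, (1 : ℝ) ∂(targetMeasure a) := by simp
    _ ≤ _ := setIntegral_mono_on (integrable_const _).integrableOn
        (integrable_one_add_sq_norm_targetMeasure ha hL).integrableOn
        (measurableSet_logCube d n).compl fun y _ => by
          linarith [sq_nonneg ‖y‖]

/-- Arbitrary centres need be neither measurable nor bounded. Doubling the radius allows centres
inside the class, so that Hoeffding's inequality applies to them. -/
lemma exists_finset_cover {smin : ℝ} {n : ℕ} {M : Set (VField d)} {τ : ℝ≥0}
    (h : coveringNum smin n M τ ≠ ⊤) :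
    ∃ T : Finset (VField d), ↑T ⊆ M ∧ T.card ≤ (coveringNum smin n M τ).toNat ∧
      ∀ w ∈ M, ∃ u ∈ T, ∀ y ∈ logCube d n, |loss smin w y - loss smin u y| ≤ 2 * τ := by
  classical
  have hle : Metric.coveringNumber (2 * τ) (lossClass smin n M) ≤ coveringNum smin n M τ :=
    Metric.coveringNumber_two_mul_le_externalCoveringNumber τ _
  obtain ⟨C, hCM, hfin, hcov, hcard⟩ := Metric.exists_set_encard_eq_coveringNumber
    (ne_top_of_le_ne_top h hle)
  -- One vector field is chosen for each centre, so `T` is no larger than the cover.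
  obtain ⟨T, hTM, hbij⟩ := Set.exists_subset_bijOn (s := M ∩
    (fun w => UniformFun.ofFun fun y : logCube d n => loss smin w (y : E d)) ⁻¹' C)
    (f := fun w => UniformFun.ofFun fun y : logCube d n => loss smin w (y : E d))
  have himg : (fun w => UniformFun.ofFun fun y : logCube d n => loss smin w (y : E d)) ''
      (M ∩ (fun w => UniformFun.ofFun fun y : logCube d n => loss smin w (y : E d)) ⁻¹' C) = C := by
    rw [Set.image_inter_preimage]
    exact Set.inter_eq_right.2 hCM
  rw [himg] at hbij
  have hTfin : T.Finite := hbij.finite_iff_finite.2 hfin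
  refine ⟨hTfin.toFinset, by
    rw [Set.Finite.coe_toFinset]; exact hTM.trans Set.inter_subset_left, ?_, fun w hw => ?_⟩
  · have h1 : T.encard = C.encard := by
      rw [← hbij.image_eq, hbij.injOn.encard_image]
    have h2 : ((hTfin.toFinset.card : ℕ) : ℕ∞) ≤ coveringNum smin n M τ := by
      rw [← hTfin.encard_eq_coe_toFinset_card, h1, hcard]
      exact hle
    rw [← ENat.natCast_toNat h] at h2
    exact_mod_cast h2
  · obtain ⟨c, hc, hd⟩ := hcov ⟨w, hw, rfl⟩
    obtain ⟨u, hu, rfl⟩ := hbij.surjOn hc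
    refine ⟨u, hTfin.mem_toFinset.2 hu, fun y hy => ?_⟩
    have h3 := (UniformFun.edist_le.1 hd) ⟨y, hy⟩
    simp only [UniformFun.toFun_ofFun] at h3
    rw [edist_dist, Real.dist_eq] at h3
    have h4 := (ENNReal.ofReal_le_iff_le_toReal ENNReal.coe_ne_top).1 h3
    simpa using h4

/-! ### Constants and tail estimates. -/

lemma exists_forall_log_pow_mul_exp_le (A : ℝ) (hA : 0 ≤ A) :
    ∃ n₀ : ℕ, ∀ n : ℕ, n₀ ≤ n → 1 ≤ Real.log n ∧
      A * Real.log n ^ 6 * Real.exp (-(Real.log n ^ 2 / 4)) ≤ 1 / (2 * (n : ℝ) ^ 2) := by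
  have hlog : Filter.Tendsto (fun n : ℕ => Real.log n) Filter.atTop Filter.atTop :=
    Real.tendsto_log_atTop.comp tendsto_natCast_atTop_atTop
  have h1 := (Real.tendsto_pow_mul_exp_neg_atTop_nhds_zero 6).const_mul A
  rw [mul_zero] at h1
  have h2 : ∀ᶠ l : ℝ in Filter.atTop, A * (l ^ 6 * Real.exp (-l)) < 1 / 2 :=
    h1.eventually_lt_const (by norm_num)
  obtain ⟨n₀, hn₀⟩ := Filter.eventually_atTop.1
    (hlog.eventually (h2.and (Filter.eventually_ge_atTop 12)))
  refine ⟨n₀, fun n hn => ?_⟩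
  obtain ⟨h3, h4⟩ := hn₀ n hn
  refine ⟨by linarith, ?_⟩
  have hn0 : (0 : ℝ) < n := by
    rcases Nat.eq_zero_or_pos n with rfl | h
    · norm_num at h4
    · exact Nat.cast_pos.2 h
  -- For `log n ≥ 12` one has `log(n)^2 / 4 ≥ 3 log n`: two of the three logarithms give `n⁻²`, the
  -- third beats `A log(n)^6`.
  have h5 : Real.exp (-(Real.log n ^ 2 / 4)) ≤ Real.exp (-Real.log n) * ((n : ℝ) ^ 2)⁻¹ := by
    have : ((n : ℝ) ^ 2)⁻¹ = Real.exp (-(2 * Real.log n)) := by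
      rw [Real.exp_neg, two_mul, Real.exp_add, Real.exp_log hn0, sq]
    rw [this, ← Real.exp_add]
    exact Real.exp_le_exp.2 (by nlinarith)
  calc _ ≤ A * Real.log n ^ 6 * (Real.exp (-Real.log n) * ((n : ℝ) ^ 2)⁻¹) := by gcongr
    _ = A * (Real.log n ^ 6 * Real.exp (-Real.log n)) * ((n : ℝ) ^ 2)⁻¹ := by ring
    _ ≤ 1 / 2 * ((n : ℝ) ^ 2)⁻¹ := by gcongr
    _ = _ := by rw [one_div, one_div, mul_inv]

lemma fieldBound_le {L : ℝ} {n : ℕ} (hn : 1 ≤ Real.log n) :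
    fieldBound L n ≤ (3 + 2 * Real.exp (2 * L)) * Real.log n ^ 3 := by
  have h1 : Real.log n ≤ Real.log n ^ 3 := le_self_pow₀ hn (by norm_num)
  have h2 : Real.log n ^ 2 ≤ Real.log n ^ 3 := pow_le_pow_right₀ hn (by norm_num)
  have h3 : 1 ≤ Real.log n ^ 3 := one_le_pow₀ hn
  have h4 := mul_le_mul_of_nonneg_left h2 (Real.exp_pos (2 * L)).le
  rw [fieldBound]
  linarith

lemma fieldBound_nonneg (L : ℝ) (n : ℕ) : 0 ≤ fieldBound L n := by
  have := Real.log_natCast_nonneg n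
  rw [fieldBound]
  positivity

/-- The constant in the polynomial bound for the loss. -/
noncomputable def lossConst (d : ℕ) (L c : ℝ) : ℝ :=
  2 * (d * (3 + 2 * Real.exp (2 * L)) ^ 2) + 4 * c ^ 2 * gaussianSecondMoment d + 4 * d + 1

lemma lossConst_pos (d : ℕ) (L c : ℝ) : 0 < lossConst d L c := by
  have := gaussianSecondMoment_nonneg d
  rw [lossConst]
  positivity

lemma sq_norm_le_of_abs_le_fieldBound {L : ℝ} {n : ℕ} {w : VField d}
    (h : ∀ (t : I) (x : E d) (j : Fin d), |w (t, x) j| ≤ fieldBound L n) (q : I × E d) :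
    ‖w q‖ ^ 2 ≤ d * fieldBound L n ^ 2 := by
  rw [EuclideanSpace.norm_sq_eq]
  calc ∑ j, ‖w q j‖ ^ 2 ≤ ∑ _j : Fin d, fieldBound L n ^ 2 :=
        Finset.sum_le_sum fun j _ => pow_le_pow_left₀ (norm_nonneg _) (h q.1 q.2 j) 2
    _ = _ := by simp

/-- The reserved `4 * d` in the constant later absorbs `4 * ‖y‖ ^ 2` on the cube; the `1` keeps the
constant positive when `d = 0`. -/
lemma loss_le_lossConst {L c smin : ℝ} {n : ℕ} (hn : 1 ≤ Real.log n) (hs : 0 < smin)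
    (hs1 : smin ≤ 1) (hlog : Real.log smin ^ 2 ≤ c ^ 2 * Real.log n ^ 2) {w : VField d}
    (h : ∀ (t : I) (x : E d) (j : Fin d), |w (t, x) j| ≤ fieldBound L n) (y : E d) :
    loss smin w y ≤ (lossConst d L c - 4 * d - 1) * Real.log n ^ 6 + 4 * ‖y‖ ^ 2 := by
  refine (loss_le hs hs1 (sq_norm_le_of_abs_le_fieldBound h) y).trans ?_
  have h1 : fieldBound L n ^ 2 ≤ (3 + 2 * Real.exp (2 * L)) ^ 2 * Real.log n ^ 6 := by
    calc _ ≤ ((3 + 2 * Real.exp (2 * L)) * Real.log n ^ 3) ^ 2 :=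
          pow_le_pow_left₀ (fieldBound_nonneg L n) (fieldBound_le hn) 2
      _ = _ := by ring
  have h2 : Real.log smin ^ 2 ≤ c ^ 2 * Real.log n ^ 6 :=
    hlog.trans (mul_le_mul_of_nonneg_left (pow_le_pow_right₀ hn (by norm_num)) (sq_nonneg c))
  have h3 := gaussianSecondMoment_nonneg d
  have h4 := mul_le_mul_of_nonneg_left h1 (Nat.cast_nonneg (α := ℝ) d)
  have h5 := mul_le_mul_of_nonneg_right h2 h3
  rw [lossConst]
  linarith

lemma loss_le_of_mem_logCube {L c smin : ℝ} {n : ℕ} (hn : 1 ≤ Real.log n) (hs : 0 < smin)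
    (hs1 : smin ≤ 1) (hlog : Real.log smin ^ 2 ≤ c ^ 2 * Real.log n ^ 2) {w : VField d}
    (h : ∀ (t : I) (x : E d) (j : Fin d), |w (t, x) j| ≤ fieldBound L n) {y : E d}
    (hy : y ∈ logCube d n) : loss smin w y ≤ lossConst d L c * Real.log n ^ 6 := by
  refine (loss_le_lossConst hn hs hs1 hlog h y).trans ?_
  have h1 : Real.log n ^ 2 ≤ Real.log n ^ 6 := pow_le_pow_right₀ hn (by norm_num)
  have h2 := mul_le_mul_of_nonneg_left h1 (Nat.cast_nonneg (α := ℝ) d)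
  have h3 : (0 : ℝ) ≤ Real.log n ^ 6 := by positivity
  linarith [sq_norm_le_of_mem_logCube hy]

lemma setIntegral_compl_loss_le {a : E d → ℝ} {L c smin : ℝ} (ha : Continuous a)
    (hL : ∀ x, |a x| ≤ L) {n : ℕ} (hn : 1 ≤ Real.log n) (hs : 0 < smin)
    (hs1 : smin ≤ 1) (hlog : Real.log smin ^ 2 ≤ c ^ 2 * Real.log n ^ 2) {w : VField d}
    (h : ∀ (t : I) (x : E d) (j : Fin d), |w (t, x) j| ≤ fieldBound L n) :
    ∫ y in (logCube d n)ᶜ, loss smin w y ∂(targetMeasure a) ≤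
      (lossConst d L c + 4) * tailConst d L * Real.log n ^ 6 *
        Real.exp (-(Real.log n ^ 2 / 4)) := by
  have hi := integrable_one_add_sq_norm_targetMeasure ha hL
  have hK := lossConst_pos d L c
  calc ∫ y in (logCube d n)ᶜ, loss smin w y ∂(targetMeasure a)
      ≤ ∫ y in (logCube d n)ᶜ, (lossConst d L c + 4) * Real.log n ^ 6 * (1 + ‖y‖ ^ 2)
          ∂(targetMeasure a) := by
        refine setIntegral_mono_on (integrable_loss hs hs1
          (sq_norm_le_of_abs_le_fieldBound h) ha hL).integrableOn
          (hi.const_mul _).integrableOn (measurableSet_logCube d n).compl fun y _ => ?_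
        refine (loss_le_lossConst hn hs hs1 hlog h y).trans ?_
        have h1 : (1 : ℝ) ≤ Real.log n ^ 6 := one_le_pow₀ hn
        have h2 := mul_le_mul_of_nonneg_right h1 (sq_nonneg ‖y‖)
        have h3 : 0 ≤ lossConst d L c * Real.log n ^ 6 * ‖y‖ ^ 2 := by positivity
        have h4 : 0 ≤ (d : ℝ) * Real.log n ^ 6 := by positivity
        linarith
    _ ≤ (lossConst d L c + 4) * Real.log n ^ 6 *
          (tailConst d L * Real.exp (-(Real.log n ^ 2 / 4))) := by
        rw [integral_const_mul]
        exact mul_le_mul_of_nonneg_left (setIntegral_compl_logCube_le ha hL n) (by positivity)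
    _ = _ := by ring

lemma measure_exists_notMem_logCube_le {Ω : Type*} [MeasurableSpace Ω] {P : Measure Ω}
    {a : E d → ℝ} {L : ℝ} (ha : Continuous a) (hL : ∀ x, |a x| ≤ L) {n : ℕ}
    {X : Fin n → Ω → E d} (hX : ∀ i, Measurable (X i))
    (hlaw : ∀ i, P.map (X i) = targetMeasure a) :
    P {ω | ∃ i, X i ω ∉ logCube d n} ≤
      ENNReal.ofReal (n * (tailConst d L * Real.exp (-(Real.log n ^ 2 / 4)))) := by
  have := isProbabilityMeasure_targetMeasure ha hL
  have h : {ω | ∃ i, X i ω ∉ logCube d n} = ⋃ i, X i ⁻¹' (logCube d n)ᶜ := by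
    ext ω; simp
  rw [h]
  refine (measure_iUnion_fintype_le _ _).trans ?_
  have h1 : ∀ i, P (X i ⁻¹' (logCube d n)ᶜ) ≤
      ENNReal.ofReal (tailConst d L * Real.exp (-(Real.log n ^ 2 / 4))) := fun i => by
    rw [← Measure.map_apply (hX i) (measurableSet_logCube d n).compl, hlaw i]
    refine (ENNReal.le_ofReal_iff_toReal_le (measure_ne_top _ _)
      (mul_nonneg (tailConst_nonneg d L) (Real.exp_pos _).le)).2 ?_
    exact measureReal_compl_logCube_le ha hL n
  refine (Finset.sum_le_sum fun i _ => h1 i).trans ?_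
  rw [Finset.sum_const, Finset.card_univ, Fintype.card_fin, nsmul_eq_mul,
    ENNReal.ofReal_mul (Nat.cast_nonneg _), ENNReal.ofReal_natCast]

/-- The radius of the deviation event makes the union bound over `N` functions at most
`1 / (2 n)`. -/
lemma union_bound_le {n N α b : ℝ} (hn : 1 ≤ n) (hN : 1 ≤ N) (hα : 0 < α) (hb : 0 < b) :
    N * (2 * Real.exp (-(2 * n * (b * (α + α⁻¹ * Real.log (4 * N * n) / n)) ^ 2 / b ^ 2))) ≤
      1 / (2 * n) := by
  have hNn : 1 ≤ N * n := one_le_mul_of_one_le_of_one_le hN hn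
  set l := Real.log (4 * N * n) with hl
  have hl0 : 0 ≤ l := Real.log_nonneg (by linarith)
  have h1 : l ≤ 2 * n * (b * (α + α⁻¹ * l / n)) ^ 2 / b ^ 2 := by
    -- With `β = α⁻¹ l / n`, this is `(α + β)^2 = (α - β)^2 + 4 α β`, and `α β = l / n` does not
    -- depend on `α`.
    have h2 : 2 * n * (b * (α + α⁻¹ * l / n)) ^ 2 / b ^ 2
        = 2 * n * (α - α⁻¹ * l / n) ^ 2 + 8 * l := by
      field_simp
      ring
    rw [h2]
    have : 0 ≤ 2 * n * (α - α⁻¹ * l / n) ^ 2 := by positivity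
    linarith
  calc _ ≤ N * (2 * Real.exp (-l)) := by gcongr
    _ = _ := by
      rw [Real.exp_neg, hl, Real.exp_log (by positivity)]
      field_simp
      norm_num

/-- As `log (2 N) ≥ 1 / 2` and `log n ≥ 1`, the sum of logarithms is bounded by their product. The
extra `log n` turns `log(n)^6` into `log(n)^7`. -/
lemma log_four_mul_le {n N : ℝ} (hn : 1 ≤ Real.log n) (hn0 : 0 < n) (hN : 1 ≤ N) :
    Real.log (4 * N * n) ≤ 5 * Real.log n * Real.log (2 * N) := by
  have h1 : Real.log (4 * N * n) = Real.log 2 + Real.log (2 * N) + Real.log n := by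
    rw [← Real.log_mul (by norm_num) (by positivity), ← Real.log_mul (by positivity) hn0.ne']
    ring_nf
  have h2 : Real.log 2 ≤ Real.log (2 * N) := Real.log_le_log (by norm_num) (by linarith)
  have h3 : (1 : ℝ) / 2 ≤ Real.log 2 := by linarith [Real.log_two_gt_d9]
  rw [h1]
  nlinarith

end FlowMatching

/-! ### The oracle inequality. -/

open FlowMatching in
theorem mainTheorem2 (d : ℕ) (L : ℝ≥0) (c₁ c₂ : ℝ) (hc₁ : 0 < c₁) :
    ∃ C : ℝ, 0 < C ∧ ∃ n₀ : ℕ,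
      ∀ a : E d → ℝ, ContDiff ℝ 2 a → c2Norm a = (L : ℝ≥0∞) →
      ∀ n : ℕ, n₀ ≤ n →
      ∀ σmin : ℝ, 0 < σmin →
        c₁ * Real.log n ≤ Real.log σmin⁻¹ → Real.log σmin⁻¹ ≤ c₂ * Real.log n →
      ∀ M : Set (VField d),
        (∀ w ∈ M, ∀ (t : I) (x : E d) (j : Fin d), |w (t, x) j| ≤ fieldBound L n) →
      ∀ (α : ℝ) (τ : ℝ≥0), 0 < α → α ≤ 1 → 0 < τ →
        coveringNum σmin n M τ ≠ ⊤ →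
      ∀ {Ω : Type*} [MeasurableSpace Ω] (P : Measure Ω) [IsProbabilityMeasure P]
        (X : Fin n → Ω → E d),
        (∀ i, Measurable (X i)) → iIndepFun X P → (∀ i, P.map (X i) = targetMeasure a) →
        P {ω | ¬ ∀ v ∈ M, IsMinOn (empiricalObjective σmin fun i => X i ω) M v →
            fmError a σmin v ≤
              C * ((⨅ w : M, fmError a σmin w) + (n : ℝ) ^ (-(1 / 2) : ℝ) +
                α⁻¹ * Real.log n ^ 7 / n *
                  Real.log (2 * ((coveringNum σmin n M τ).toNat : ℝ)) +
                (2 + α) * τ + α * Real.log n ^ 6)} ≤ (n : ℝ≥0∞)⁻¹ := by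
  set K := lossConst d L c₂
  have hK : 0 < K := lossConst_pos d L c₂
  have hT := tailConst_nonneg d L
  obtain ⟨n₀, hn₀⟩ := exists_forall_log_pow_mul_exp_le ((K + 4) * tailConst d L) (by positivity)
  -- `10 * K` pays for `2 * s`, through `s ≤ K α log(n)^6 + 5 K R`; `4` pays for `8 * τ ≤ 4 * (2 +
  -- α) * τ`.
  refine ⟨10 * K + 4, by positivity, n₀, ?_⟩
  intro a ha2 haL n hn σmin hσ hσ1 hσ2 M hM α τ hα hα1 hτ hcov Ω _ P _ X hX hind hlaw
  have ha : Continuous a := ha2.continuous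
  have hL := abs_le_of_c2Norm_eq haL
  have hprob := isProbabilityMeasure_targetMeasure ha hL
  obtain ⟨hlog, htail⟩ := hn₀ n hn
  have hn0 : 0 < n := Nat.pos_of_ne_zero fun h => by
    rw [h] at hlog; norm_num at hlog
  have hn0' : (0 : ℝ) < n := Nat.cast_pos.2 hn0
  have hn1 : (1 : ℝ) ≤ n := Nat.one_le_cast.2 hn0
  have hσlog : 0 ≤ Real.log σmin⁻¹ := (by positivity : 0 ≤ c₁ * Real.log n).trans hσ1
  have hsq : Real.log σmin ^ 2 ≤ c₂ ^ 2 * Real.log n ^ 2 := by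
    rw [← mul_pow, ← neg_sq, ← Real.log_inv]
    exact pow_le_pow_left₀ hσlog hσ2 2
  have hσle : σmin ≤ 1 := by
    rw [Real.log_inv] at hσlog
    exact (Real.log_nonpos_iff hσ.le).1 (by linarith)
  -- Nonemptiness is needed for `N ≥ 1` and for the infimum to be meaningful; an empty class has no
  -- minimiser.
  rcases M.eq_empty_or_nonempty with rfl | hne
  · simp
  obtain ⟨T, hTM, hTcard, hTcov⟩ := exists_finset_cover hcov
  set N : ℝ := ((coveringNum σmin n M τ).toNat : ℝ)
  have hTN : (T.card : ℝ) ≤ N := Nat.cast_le.2 hTcard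
  have hN : 1 ≤ N := by
    obtain ⟨w, hw⟩ := hne
    obtain ⟨u, hu, -⟩ := hTcov w hw
    exact le_trans (Nat.one_le_cast.2 (Finset.card_pos.2 ⟨u, hu⟩)) hTN
  have hbd := fun w (hw : w ∈ M) => sq_norm_le_of_abs_le_fieldBound (hM w hw)
  set b := K * Real.log n ^ 6 with hb
  have hb0 : 0 < b := by positivity
  set s := b * (α + α⁻¹ * Real.log (4 * N * n) / n) with hs
  have hNn : 1 ≤ N * n := one_le_mul_of_one_le_of_one_le hN hn1
  have hlog4 : 0 ≤ Real.log (4 * N * n) := Real.log_nonneg (by linarith)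
  have hs0 : 0 ≤ s := by positivity
  have hdev := measure_exists_abs_sum_sub_integral_ge_le T hX hind hlaw
    (φ := fun w => (logCube d n).indicator (loss σmin w))
    (fun w hw => (measurable_loss hσ hσle (hbd w (hTM hw))).indicator (measurableSet_logCube d n))
    (b := b) (fun w hw y => by
      by_cases hy : y ∈ logCube d n
      · rw [Set.indicator_of_mem hy]
        exact ⟨loss_nonneg hσ w y,
          loss_le_of_mem_logCube hlog hσ hσle hsq (hM w (hTM hw)) hy⟩
      · rw [Set.indicator_of_notMem hy]
        exact ⟨le_rfl, hb0.le⟩) hs0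
  have hout := measure_exists_notMem_logCube_le ha hL hX hlaw
  have hout' : n * (tailConst d L * Real.exp (-(Real.log n ^ 2 / 4))) ≤ 1 / (2 * n) := by
    have h1 : tailConst d L * Real.exp (-(Real.log n ^ 2 / 4)) ≤ 1 / (2 * (n : ℝ) ^ 2) := by
      refine le_trans ?_ htail
      have h2 : (1 : ℝ) ≤ Real.log n ^ 6 := one_le_pow₀ hlog
      gcongr
      calc tailConst d L = 1 * tailConst d L * 1 := by ring
        _ ≤ _ := by gcongr; linarith
    calc _ ≤ n * (1 / (2 * (n : ℝ) ^ 2)) := by gcongr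
      _ = _ := by field_simp
  have hdev' : T.card * (2 * Real.exp (-(2 * n * s ^ 2 / b ^ 2))) ≤ 1 / (2 * (n : ℝ)) :=
    le_trans (by gcongr) (union_bound_le hn1 hN hα hb0)
  -- The failure set lies in the union of two bad events, each of measure at most `1 / (2 n)`.
  -- Monotonicity requires no measurability of the failure set.
  refine (measure_mono (t := {ω | ∃ i, X i ω ∉ logCube d n} ∪ {ω | ∃ w ∈ T, n * s ≤
    |∑ i, (logCube d n).indicator (loss σmin w) (X i ω) -
      n * ∫ y, (logCube d n).indicator (loss σmin w) y ∂(targetMeasure a)|}) ?_).trans ?_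
  · intro ω hω
    by_contra hbad
    refine hω fun v hv hmin => ?_
    have hbad' := not_or.1 hbad
    have hcube : ∀ i, X i ω ∈ logCube d n := fun i => by
      by_contra h
      exact hbad'.1 ⟨i, h⟩
    have hsmall : ∀ w ∈ T, |∑ i, (logCube d n).indicator (loss σmin w) (X i ω) -
        n * ∫ y, (logCube d n).indicator (loss σmin w) y ∂(targetMeasure a)| ≤ n * s :=
      fun w hw => le_of_not_ge fun h => hbad'.2 ⟨w, hw, h⟩
    have hη := (setIntegral_compl_loss_le ha hL hlog hσ hσle hsq (hM v hv)).trans htail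
    have hcomp : ∀ w ∈ M, fmError a σmin v ≤
        fmError a σmin w + (2 * s + 8 * τ + 1 / (2 * (n : ℝ) ^ 2)) := fun w hw => by
      -- The minimiser `v` depends on the sample; its neighbour `v'` comes from `T`, which was fixed
      -- beforehand, so the uniform deviation bound covers it.
      obtain ⟨v', hv', hvv'⟩ := hTcov v hv
      obtain ⟨w', hw', hww'⟩ := hTcov w hw
      have hint := fun u (hu : u ∈ M) => integrable_loss hσ hσle (hbd u hu) ha hL
      have hle : ∑ i, loss σmin v (X i ω) ≤ ∑ i, loss σmin w (X i ω) := by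
        have h := isMinOn_iff.1 hmin w hw
        simp only [empiricalObjective] at h
        exact le_of_mul_le_mul_left h (by positivity)
      have h := integral_le_of_sum_le hn0 (measurableSet_logCube d n) hcube (hint v hv)
        (hint w hw) (hint v' (hTM hv')) (hint w' (hTM hw')) (loss_nonneg hσ w)
        (δ := 2 * τ) (by positivity) hη hvv' hww' (hsmall v' hv') (hsmall w' hw') hle
      -- `lossVariance` appears on both sides and cancels.
      rw [integral_loss_eq hσ hσle (hbd v hv) ha hL, integral_loss_eq hσ hσle (hbd w hw) ha hL] at h
      linarith
    have : Nonempty M := hne.to_subtype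
    have hinf : fmError a σmin v - (2 * s + 8 * τ + 1 / (2 * (n : ℝ) ^ 2)) ≤
        ⨅ w : M, fmError a σmin w :=
      -- The comparison holds on one event for all competitors, so the infimum need not be attained.
      le_ciInf fun w => by linarith [hcomp w w.2]
    have hinf0 : 0 ≤ ⨅ w : M, fmError a σmin w :=
      Real.iInf_nonneg fun w => fmError_nonneg hσ ha hL w
    have hroot : 1 / (2 * (n : ℝ) ^ 2) ≤ (n : ℝ) ^ (-(1 / 2) : ℝ) := by
      calc 1 / (2 * (n : ℝ) ^ 2) ≤ ((n : ℝ) ^ 2)⁻¹ := by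
            rw [one_div]
            exact inv_anti₀ (by positivity) (by nlinarith [sq_nonneg (n : ℝ)])
        _ = (n : ℝ) ^ (-2 : ℝ) := by
            rw [Real.rpow_neg hn0'.le]
            norm_num
        _ ≤ _ := Real.rpow_le_rpow_of_exponent_le hn1 (by norm_num)
    have hroot0 : 0 ≤ (n : ℝ) ^ (-(1 / 2) : ℝ) := by positivity
    have hlogN : 0 ≤ Real.log (2 * N) := Real.log_nonneg (by linarith)
    set R := α⁻¹ * Real.log n ^ 7 / n * Real.log (2 * N) with hR
    have hR0 : 0 ≤ R := by positivity
    have hsR : s ≤ K * (α * Real.log n ^ 6) + 5 * K * R := by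
      calc s ≤ b * (α + α⁻¹ * (5 * Real.log n * Real.log (2 * N)) / n) := by
            rw [hs]
            gcongr
            exact log_four_mul_le hlog hn0' hN
        _ = _ := by rw [hb, hR]; ring
    have hα6 : 0 ≤ α * Real.log n ^ 6 := by positivity
    have hτ0 : 0 ≤ (τ : ℝ) := τ.2
    have hατ : 0 ≤ α * (τ : ℝ) := by positivity
    have e1 := mul_nonneg hK.le hinf0
    have e2 := mul_nonneg hK.le hroot0
    have e3 := mul_nonneg hK.le hR0
    have e4 := mul_nonneg hK.le hα6
    have e5 := mul_nonneg hK.le hτ0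
    have e6 := mul_nonneg hK.le hατ
    linarith
  · refine (measure_union_le _ _).trans ((add_le_add (hout.trans (ENNReal.ofReal_le_ofReal hout'))
      (hdev.trans (ENNReal.ofReal_le_ofReal hdev'))).trans (le_of_eq ?_))
    rw [← ENNReal.ofReal_add (by positivity) (by positivity), ← ENNReal.ofReal_natCast,
      ← ENNReal.ofReal_inv_of_pos hn0']
    congr 1
    field_simp
    norm_num
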